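/- Let $\mathbb K$ be a field of characteristic $0$, and let $q\in\mathbb K^*$ be such that the least positive integer $\ell$ with $[\ell]:=\frac{q^{\ell}-q^{-\ell}}{q-q^{-1}}=0$ exists and is at least $3$. Let $m\ge 2$, $n\ge 0$, $r\ge 1$ and $0\le s\le N:=m(r\ell-1)+n$. Let $\Omega_q(m|n)$ be the quantum Grassmann superalgebra, with monomial basis $x^{(\alpha)}\otimes x^{\mu}$ ($\alpha\in\mathbb Z_{\ge 0}^m$, $\mu\in\{0,1\}^n$), regarded as a module over $\mathcal U_q=u_q(\mathfrak{gl}(m|n))$. Writing $a=(\alpha,\mu)$ and $x^a=x^{(\alpha)}\otimes x^\mu$, the generators act as follows: $e_i$ and $f_i$ $(1\le i<m+n)$ send $x^{a}$ to $c_i(a)\,x^{a+\varepsilon_i-\varepsilon_{i+1}}$ and $c_{i+1}(a)\,x^{a+\varepsilon_{i+1}-\varepsilon_i}$ respectively, where $c_k(a)=[a_k+1]$ for $k\le m$, $c_k(a)=1$ for $k>m$, and $x^b:=0$ if $b$ is not an admissible exponent; $K_i$ acts by $q^{a_i}$ for $i\le m$ and by $q^{-a_i}$ for $i>m$. For $t\ge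 1$ let $\Omega_q^{(s)}(m|n,\mathbf t)$ be the $\mathcal U_q$-submodule spanned by the $x^{(\alpha)}\otimes x^\mu$ with $|\alpha|+|\mu|=s$ and $\alpha_j\le t\ell-1$ for all $j$. The energy grade of $x^{(\alpha)}\otimes x^\mu$ is $\sum_{j=1}^m\lfloor\alpha_j/\ell\rfloor$; let $E_0(s)$ and $E(s)$ be its minimum and its maximum over the monomials of $\Omega_q^{(s)}(m|n,\mathbf r)$. For $0\le i\le E(s)-E_0(s)$ let $\mathcal V_i$ be the span of the monomials of $\Omega_q^{(s)}(m|n,\mathbf r)$ of energy grade at most $E_0(s)+i$, put $\mathcal V_{-1}=0$, and let $$\mathcal K_i^{(s)}=\Bigl\{(k_1,\dots,k_m)\in\mathbb Z_{\ge 0}^m\ \Big|\ \sum_j k_j=E_0(s)+i,\ k_j\le r-1\text{ for all }j\Bigr\},\qquad s_i'=s-(E_0(s)+i)\ell .$$ Then $0\le s_i'\le m(\ell-1)+n$, and the following hold. (1) For $0\le i\le E(s)-E_0(s)$, $\mathcal V_i$ is the $(i+1)$-st term $\mathrm{Soc}^{i+1}$ of the socle filtration of the $\mathcal U_q$-module $\Omega_q^{(s)}(m|n,\mathbf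 r)$. The $i$-th Loewy layer $\mathcal V_i/\mathcal V_{i-1}$ is semisimple, and the number of its simple constituents is $$\sharp\,\mathcal K_i^{(s)}=\sum_{j=0}^{\lfloor (E_0(s)+i)/r\rfloor}(-1)^j\binom mj\binom{m+(E_0(s)+i)-jr-1}{m-1}.$$ (2) For $0\le i\le E(s)-E_0(s)$, $$\dim \mathcal V_i/\mathcal V_{i-1}=\sharp\,\mathcal K_i^{(s)}\cdot\dim\Omega_q^{(s_i')}(m|n,\mathbf 1),\qquad \dim\Omega_q^{(s_i')}(m|n,\mathbf 1)=\sum_{h=0}^{n}\sum_{j=0}^{\lfloor (s_i'-h)/\ell\rfloor}(-1)^j\binom nh\binom mj\binom{m+s_i'-h-j\ell-1}{m-1},$$ and $$\begin{aligned}\dim\Omega_q^{(s)}(m|n,\mathbf r)&=\sum_{h=0}^{n}\sum_{j=0}^{\lfloor\frac{s-h}{r\ell}\rfloor}(-1)^j\binom nh\binom mj\binom{m+s-h-jr\ell-1}{m-1}\\&=\sum_{i=0}^{E(s)-E_0(s)}\Biggl(\sum_{j=0}^{\lfloor\frac{E_0(s)+i}{r}\rfloor}(-1)^j\binom mj\binom{m+(E_0(s)+i)-jr-1}{m-1}\Biggr)\Biggl(\sum_{h=0}^{n}\sum_{j=0}^{\lfloor\frac{s_i'-h}{\ell}\rfloor}(-1)^j\binom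 nh\binom mj\binom{m+s_i'-h-j\ell-1}{m-1}\Biggr),\end{aligned}$$ where a sum over $j$ with negative upper limit is empty. -/

import Mathlib

open Finset

noncomputable section

/-! ### The quantum Grassmann superalgebra as a module -/

/-- The quantum integer `[k] = (q^k - q^{-k}) / (q - q^{-1})`. -/
def qInt {K : Type*} [Field K] (q : K) (k : ℕ) : K :=
  (q ^ k - (q ^ k)⁻¹) / (q - q⁻¹)

/-- `char(q) = ℓ`: the least positive integer `ℓ` with `[ℓ] = 0` is `ℓ`. -/
def QCharEq {K : Type*} [Field K] (q : K) (ℓ : ℕ) : Prop :=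
  IsLeast {k : ℕ | 0 < k ∧ qInt q k = 0} ℓ

/-- The exponents `⟨α, μ⟩` with `α ∈ ℕ^m` (the first `m` entries) and `μ ∈ {0,1}^n` (the last `n`
entries). -/
def SuperExp (m n : ℕ) : Type :=
  {a : Fin (m + n) → ℕ // ∀ i, m ≤ i.val → a i ≤ 1}

/-- The underlying space of `Ω_q(m|n) = A_q(m) ⊗ Λ_{q⁻¹}(n)`, with its monomial basis
`x^{(α)} ⊗ x^μ`. -/
def Grassmann (K : Type*) [Field K] (m n : ℕ) : Type _ := SuperExp m n →₀ K

instance Grassmann.instAddCommGroup (K : Type*) [Field K] (m n : ℕ) :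
    AddCommGroup (Grassmann K m n) :=
  inferInstanceAs (AddCommGroup (SuperExp m n →₀ K))

instance Grassmann.instModule (K : Type*) [Field K] (m n : ℕ) : Module K (Grassmann K m n) :=
  inferInstanceAs (Module K (SuperExp m n →₀ K))

/-- The monomial basis `x^{(α)} ⊗ x^μ` of `Ω_q(m|n)`. -/
def monoBasis (K : Type*) [Field K] (m n : ℕ) :
    Module.Basis (SuperExp m n) K (Grassmann K m n) :=
  Module.Basis.ofRepr (LinearEquiv.refl K (SuperExp m n →₀ K))

/-- The basis vector `x^{(α)} ⊗ x^μ`. -/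
def mono (K : Type*) [Field K] {m n : ℕ} (a : SuperExp m n) : Grassmann K m n :=
  monoBasis K m n a

/-- The exponent `a + ε_i - ε_j`, when it makes sense: `a_j > 0`, and `a_i = 0` if `i` is odd. -/
def SuperExp.shift {m n : ℕ} (a : SuperExp m n) (i j : Fin (m + n))
    (h : 0 < a.1 j ∧ (m ≤ i.val → a.1 i = 0)) : SuperExp m n :=
  ⟨fun k => a.1 k + (if k = i then 1 else 0) - (if k = j then 1 else 0), by
    intro k hk
    have h1 := a.2 k hk
    by_cases hki : k = i
    · subst hki
      have h2 := h.2 hk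
      simp only [if_true]
      omega
    · simp only [hki, if_false]
      omega⟩

open Classical in
/-- The operator sending `x^a` to `c_i(a) x^{a + ε_i - ε_j}`, where `c_i(a) = [a_i + 1]` for `i`
even and `c_i(a) = 1` for `i` odd; it is zero if `a + ε_i - ε_j` is not an exponent. -/
def moveOp {K : Type*} [Field K] (q : K) {m n : ℕ} (i j : Fin (m + n)) :
    Module.End K (Grassmann K m n) :=
  (monoBasis K m n).constr K fun a =>
    if h : 0 < a.1 j ∧ (m ≤ i.val → a.1 i = 0) then
      (if i.val < m then qInt q (a.1 i + 1) else 1) • mono K (a.shift i j h)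
    else 0

/-- The action of `e_i`, for two consecutive indices `i`, `i + 1`. -/
def eOp {K : Type*} [Field K] (q : K) {m n : ℕ} (i : ℕ) (hi : i + 1 < m + n) :
    Module.End K (Grassmann K m n) :=
  moveOp q ⟨i, by omega⟩ ⟨i + 1, hi⟩

/-- The action of `f_i`, for two consecutive indices `i`, `i + 1`. -/
def fOp {K : Type*} [Field K] (q : K) {m n : ℕ} (i : ℕ) (hi : i + 1 < m + n) :
    Module.End K (Grassmann K m n) :=
  moveOp q ⟨i + 1, hi⟩ ⟨i, by omega⟩

/-- The action of `K_i`: `x^a ↦ q^{a_i} x^a` for `i` even, `x^a ↦ q^{-a_i} x^a` for `i` odd.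
The action of `K_i⁻¹` is obtained by replacing `q` by `q⁻¹`. -/
def kOp {K : Type*} [Field K] (q : K) {m n : ℕ} (i : Fin (m + n)) :
    Module.End K (Grassmann K m n) :=
  (monoBasis K m n).constr K fun a =>
    (if i.val < m then q ^ a.1 i else (q⁻¹) ^ a.1 i) • mono K a

/-- The image of the quantum superalgebra `u_q(gl(m|n))` in the endomorphisms of `Ω_q(m|n)`: the
algebra generated by the actions of the `e_i`, `f_i`, `K_i`, `K_i⁻¹`.  Submodules, quotients,
simplicity, socles and lengths over `u_q(gl(m|n))` and over this image are the same thing. -/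
def quantumAction {K : Type*} [Field K] (q : K) (m n : ℕ) :
    Subalgebra K (Module.End K (Grassmann K m n)) :=
  Algebra.adjoin K
    ({T | ∃ (i : ℕ) (hi : i + 1 < m + n), T = eOp q i hi ∨ T = fOp q i hi} ∪
      {T | ∃ i : Fin (m + n), T = kOp q i ∨ T = kOp q⁻¹ i})

/-- The set of exponents `⟨α, μ⟩` with `|α| + |μ| = s` and `α_i ≤ b - 1` for all `i`. -/
def truncExp (m n b s : ℕ) : Set (SuperExp m n) :=
  {a | (∀ i : Fin (m + n), i.val < m → a.1 i < b) ∧ ∑ i, a.1 i = s}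

/-- The energy grade `∑_{i ≤ m} ⌊α_i / ℓ⌋`. -/
def energy (ℓ : ℕ) {m n : ℕ} (a : SuperExp m n) : ℕ :=
  ∑ i : Fin m, a.1 (Fin.castAdd n i) / ℓ

/-- The lowest energy grade `E_0(s)` in `Ω_q^{(s)}(m|n, 𝐫)`. -/
def minEnergy (m n ℓ r s : ℕ) : ℕ := sInf (energy ℓ '' truncExp m n (r * ℓ) s)

/-- The highest energy grade `E(s)` in `Ω_q^{(s)}(m|n, 𝐫)`. -/
def maxEnergy (m n ℓ r s : ℕ) : ℕ := sSup (energy ℓ '' truncExp m n (r * ℓ) s)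

/-- The span of a set of monomials. -/
def monoSpan (K : Type*) [Field K] {m n : ℕ} (S : Set (SuperExp m n)) :
    Submodule K (Grassmann K m n) :=
  Submodule.span K (mono K '' S)

lemma qInt_mul_eq_zero {K : Type*} [Field K] {q : K} {ℓ : ℕ} (h : qInt q ℓ = 0) (r : ℕ) :
    qInt q (r * ℓ) = 0 := by
  unfold qInt at *
  rcases div_eq_zero_iff.1 h with h | h
  · have h1 : q ^ ℓ = (q ^ ℓ)⁻¹ := sub_eq_zero.1 h
    rw [mul_comm, pow_mul, ← inv_pow, ← h1, sub_self, zero_div]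
  · rw [h, div_zero]

lemma sum_shift {m n : ℕ} (a : SuperExp m n) (i j : Fin (m + n))
    (h : 0 < a.1 j ∧ (m ≤ i.val → a.1 i = 0)) : ∑ k, (a.shift i j h).1 k = ∑ k, a.1 k := by
  have h1 : ∑ k, ((a.shift i j h).1 k + if k = j then 1 else 0)
      = ∑ k, (a.1 k + if k = i then 1 else 0) := by
    refine Finset.sum_congr rfl fun k _ => ?_
    simp only [SuperExp.shift]
    by_cases hk : k = j
    · subst hk
      have := h.1
      simp only [if_true]
      omega
    · simp [hk]
  rw [Finset.sum_add_distrib, Finset.sum_add_distrib] at h1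
  simpa using h1

lemma moveOp_mem {K : Type*} [Field K] {q : K} {m n b s : ℕ} (hb : qInt q b = 0)
    (i j : Fin (m + n)) {x : Grassmann K m n} (hx : x ∈ monoSpan K (truncExp m n b s)) :
    moveOp q i j x ∈ monoSpan K (truncExp m n b s) := by
  refine Submodule.span_induction (p := fun x _ => moveOp q i j x ∈ monoSpan K (truncExp m n b s))
    ?_ ?_ ?_ ?_ hx
  · rintro _ ⟨a, ha, rfl⟩
    simp only [moveOp, mono, Module.Basis.constr_basis]
    split_ifs with h hi
    · by_cases hab : a.1 i + 1 = b
      · rw [hab, hb, zero_smul]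
        exact Submodule.zero_mem _
      · refine Submodule.smul_mem _ _ (Submodule.subset_span ⟨_, ⟨fun k hk => ?_, ?_⟩, rfl⟩)
        · have h1 := ha.1 k hk
          simp only [SuperExp.shift]
          by_cases hki : k = i
          · subst hki
            simp only [if_true]
            omega
          · simp only [hki, if_false]
            omega
        · rw [sum_shift]
          exact ha.2
    · refine Submodule.smul_mem _ _ (Submodule.subset_span ⟨_, ⟨fun k hk => ?_, ?_⟩, rfl⟩)
      · have h1 := ha.1 k hk
        have hki : k ≠ i := fun e => hi (e ▸ hk)
        simp only [SuperExp.shift, hki, if_false]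
        omega
      · rw [sum_shift]
        exact ha.2
    · exact Submodule.zero_mem _
  · rw [map_zero]
    exact Submodule.zero_mem _
  · intro x y _ _ h1 h2
    rw [map_add]
    exact Submodule.add_mem _ h1 h2
  · intro c x _ h1
    rw [map_smul]
    exact Submodule.smul_mem _ _ h1

lemma kOp_mem {K : Type*} [Field K] {q : K} {m n : ℕ} {S : Set (SuperExp m n)}
    (i : Fin (m + n)) {x : Grassmann K m n} (hx : x ∈ monoSpan K S) :
    kOp q i x ∈ monoSpan K S := by
  refine Submodule.span_induction (p := fun x _ => kOp q i x ∈ monoSpan K S) ?_ ?_ ?_ ?_ hx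
  · rintro _ ⟨a, ha, rfl⟩
    simp only [kOp, mono, Module.Basis.constr_basis]
    exact Submodule.smul_mem _ _ (Submodule.subset_span ⟨a, ha, rfl⟩)
  · rw [map_zero]
    exact Submodule.zero_mem _
  · intro x y _ _ h1 h2
    rw [map_add]
    exact Submodule.add_mem _ h1 h2
  · intro c x _ h1
    rw [map_smul]
    exact Submodule.smul_mem _ _ h1

lemma quantumAction_mem {K : Type*} [Field K] {q : K} {m n b s : ℕ} (hb : qInt q b = 0)
    {T : Module.End K (Grassmann K m n)} (hT : T ∈ quantumAction q m n)
    {x : Grassmann K m n} (hx : x ∈ monoSpan K (truncExp m n b s)) :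
    T x ∈ monoSpan K (truncExp m n b s) := by
  refine Algebra.adjoin_induction
    (p := fun T _ => ∀ x ∈ monoSpan K (truncExp m n b s), T x ∈ monoSpan K (truncExp m n b s))
    ?_ ?_ ?_ ?_ hT x hx
  · rintro T (⟨i, hi, rfl | rfl⟩ | ⟨i, rfl | rfl⟩) x hx
    · exact moveOp_mem hb _ _ hx
    · exact moveOp_mem hb _ _ hx
    · exact kOp_mem _ hx
    · exact kOp_mem _ hx
  · intro c x hx
    rw [Module.algebraMap_end_apply]
    exact Submodule.smul_mem _ _ hx
  · intro S T _ _ h1 h2 x hx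
    exact Submodule.add_mem _ (h1 x hx) (h2 x hx)
  · intro S T _ _ h1 h2 x hx
    exact h1 _ (h2 x hx)

/-- The truncated homogeneous `u_q(gl(m|n))`-module `Ω_q^{(s)}(m|n, 𝐫)`, `𝐫 = (rℓ-1, …, rℓ-1)`:
the span of the monomials `x^{(α)} ⊗ x^μ` with `|α| + |μ| = s` and `α ≤ 𝐫`. -/
def truncGrassmann {K : Type*} [Field K] {q : K} {ℓ : ℕ} (hq : QCharEq q ℓ) (m n r s : ℕ) :
    Submodule (quantumAction q m n) (Grassmann K m n) where
  carrier := monoSpan K (truncExp m n (r * ℓ) s)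
  add_mem' := Submodule.add_mem _
  zero_mem' := Submodule.zero_mem _
  smul_mem' := fun T _ hx => quantumAction_mem (qInt_mul_eq_zero hq.1.2 r) T.2 hx

/-! ### The socle filtration -/

/-- The socle of a module: the sum of its simple submodules. -/
def socle (R M : Type*) [Ring R] [AddCommGroup M] [Module R M] : Submodule R M :=
  sSup {N : Submodule R M | IsSimpleModule R N}

/-- The socle filtration: `Soc^0 M = 0` and `Soc^{k+1} M / Soc^k M = Soc (M / Soc^k M)`. -/
def socleFiltration (R M : Type*) [Ring R] [AddCommGroup M] [Module R M] : ℕ → Submodule R M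
  | 0 => ⊥
  | k + 1 => (socle R (M ⧸ socleFiltration R M k)).comap (socleFiltration R M k).mkQ

/-- The `i`-th Loewy layer `Soc^{i+1} M / Soc^i M`, `i ≥ 0`. -/
abbrev LoewyLayer (R M : Type*) [Ring R] [AddCommGroup M] [Module R M] (i : ℕ) : Type _ :=
  socleFiltration R M (i + 1) ⧸
    (socleFiltration R M i).submoduleOf (socleFiltration R M (i + 1))

/-! ### The combinatorial quantities -/

/-- `𝒦(k)`: the tuples `(k_1, …, k_m)` of nonnegative integers with sum `k` and all
`k_j ≤ r - 1`. -/
def energyTuples (m r k : ℕ) : Set (Fin m → ℕ) :=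
  {κ | ∑ j, κ j = k ∧ ∀ j, κ j < r}

/-- `∑_{j=0}^{⌊k/r⌋} (-1)^j C(m,j) C(m+k-jr-1, m-1)`. -/
def tupleSum (m r k : ℕ) : ℤ :=
  ∑ j ∈ range (k / r + 1),
    (-1) ^ j * (m.choose j : ℤ) * ((m + k - j * r - 1).choose (m - 1) : ℤ)

/-- `∑_{i=0}^{n} ∑_{j=0}^{⌊(s-i)/b⌋} (-1)^j C(n,i) C(m,j) C(m+s-i-jb-1, m-1)`; the inner sum is
empty for `i > s`. -/
def dimSum (m n b s : ℕ) : ℤ :=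
  ∑ i ∈ range (min n s + 1), ∑ j ∈ range ((s - i) / b + 1),
    (-1) ^ j * (n.choose i : ℤ) * (m.choose j : ℤ) *
      ((m + s - i - j * b - 1).choose (m - 1) : ℤ)

end

/-! Divide each even entry of an exponent by `ℓ`: the monomial becomes a pair of a quotient vector κ
(`SuperExp.quot`) and a residue vector (`SuperExp.res`, which keeps the odd entries). The energy is
the sum of κ.

Raising an even entry a_i has coefficient [a_i + 1], which is zero exactly when a carry would occur.
Thus κ never increases under the action, and every lower set of quotient vectors spans a submodule
(`quotSpan`). With κ fixed, the residues behave like particles hopping between neighbouring sites of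
capacity ℓ - 1 (even) or 1 (odd). All configurations with the same number of particles are connected
(`hop_connected`), and the operator realising a path does not depend on κ (`exists_movesRes`). The
weights for the K_i determine the residues, so κ and the weight determine the monomial. Enlarging a
lower set by one occurring κ therefore gives a simple quotient (`quotSpan_covBy`). Tuples of equal
energy are incomparable, so each energy layer is a sum of simple modules, one for each κ.

No larger semisimple layer is possible. Above energy E, enough free places remain to empty an even
site j and then take one more particle from it. This borrows from κ_j and lowers the energy by one,
again uniformly in κ (`exists_lowering`). A submodule covering the part of energy below E, but
reaching beyond E, would then contain a proper intermediate submodule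
(`le_of_quotSpan_sumLower_covBy`). Hence the energy filtration is the socle filtration.

The counting uses the generating function of bounded tuples, and the bijection between monomials of
energy E and pairs of a quotient vector and a residue vector (`ncard_energy_eq`). -/

/-! ### Counting bounded tuples -/

/-- The tuples with entries below `c` and with sum `k`, as a finite set. -/
def boundedTuples {ι : Type*} [Fintype ι] [DecidableEq ι] (c : ι → ℕ) (k : ℕ) : Finset (ι → ℕ) :=
  (Fintype.piFinset fun i => range (c i)).filter fun a => ∑ i, a i = k

lemma mem_boundedTuples {ι : Type*} [Fintype ι] [DecidableEq ι] {c : ι → ℕ} {k : ℕ} {a : ι → ℕ} :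
    a ∈ boundedTuples c k ↔ (∀ i, a i < c i) ∧ ∑ i, a i = k := by
  simp [boundedTuples]

/-- Expanding the product, each choice of one power from every factor is a tuple, and it contributes
X to the sum of its entries. -/
lemma card_boundedTuples {ι : Type*} [Fintype ι] [DecidableEq ι] (c : ι → ℕ) (k : ℕ) :
    ((boundedTuples c k).card : ℤ) =
      PowerSeries.coeff k (∏ i, ∑ x ∈ range (c i), (PowerSeries.X : PowerSeries ℤ) ^ x) := by
  rw [Finset.prod_univ_sum, map_sum]
  simp only [Finset.prod_pow_eq_pow_sum, PowerSeries.coeff_X_pow]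
  rw [boundedTuples, Finset.card_filter]
  push_cast
  exact Finset.sum_congr rfl fun a _ => by simp only [eq_comm]

lemma geom_pow_eq (b m : ℕ) :
    (∑ x ∈ range b, (PowerSeries.X : PowerSeries ℤ) ^ x) ^ m =
      (1 - PowerSeries.X ^ b) ^ m * (PowerSeries.invOneSubPow ℤ m : PowerSeries ℤ) := by
  rw [← geom_sum_mul_neg, mul_pow, mul_assoc, ← PowerSeries.invOneSubPow_inv_eq_one_sub_pow,
    Units.inv_val, mul_one]

/-- The series is (1 - X^b)^m (1 - X)^(-m): the first factor is expanded by the binomial theorem,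
the second has coefficients C(m - 1 + k, m - 1). -/
lemma coeff_geom_pow {m b : ℕ} (hm : 1 ≤ m) (hb : 1 ≤ b) (k : ℕ) :
    PowerSeries.coeff k ((∑ x ∈ range b, (PowerSeries.X : PowerSeries ℤ) ^ x) ^ m) =
      tupleSum m b k := by
  obtain ⟨d, rfl⟩ : ∃ d, m = d + 1 := ⟨m - 1, by omega⟩
  have h1 : (1 - (PowerSeries.X : PowerSeries ℤ) ^ b) ^ (d + 1) =
      ∑ j ∈ range (d + 1 + 1), PowerSeries.X ^ (j * b) *
        PowerSeries.C ((-1 : ℤ) ^ j * ((d + 1).choose j : ℤ)) := by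
    rw [sub_eq_neg_add, add_pow]
    refine Finset.sum_congr rfl fun j _ => ?_
    rw [neg_pow, one_pow, mul_one, ← pow_mul]
    simp only [map_mul, map_pow, map_neg, map_one, map_natCast]
    rw [mul_comm b j]
    ring
  rw [geom_pow_eq, h1, Finset.sum_mul, map_sum, tupleSum,
    PowerSeries.invOneSubPow_val_succ_eq_mk_add_choose]
  simp only [mul_assoc, PowerSeries.coeff_X_pow_mul', PowerSeries.coeff_C_mul,
    PowerSeries.coeff_mk]
  rw [← Finset.sum_filter]
  have h2 : ∀ j, j * b ≤ k ↔ j < k / b + 1 := fun j => by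
    rw [Nat.lt_succ_iff, Nat.le_div_iff_mul_le hb]
  have h3 : (range (d + 1 + 1)).filter (fun j => j * b ≤ k) ⊆ range (k / b + 1) := by
    intro j
    simp only [Finset.mem_filter, Finset.mem_range, h2]
    exact fun h => h.2
  -- The two index sets differ only in j > m, where C(m, j) = 0. For the common indices j * b ≤ k,
  -- so the natural subtractions do not truncate.
  rw [← Finset.sum_subset h3]
  · refine Finset.sum_congr rfl fun j hj => ?_
    have := (Finset.mem_filter.1 hj).2
    rw [show d + 1 + k - j * b - 1 = d + (k - j * b) by omega, show d + 1 - 1 = d by omega]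
  · intro j hj hj'
    have h4 : d + 1 < j := by
      simp only [Finset.mem_filter, Finset.mem_range, h2, not_and, not_lt] at hj hj'
      by_contra h
      have := hj' (by omega)
      omega
    rw [Nat.choose_eq_zero_of_lt h4]
    simp

lemma coeff_geom_pow_mul {m b : ℕ} (hm : 1 ≤ m) (hb : 1 ≤ b) (n s : ℕ) :
    PowerSeries.coeff s ((∑ x ∈ range b, (PowerSeries.X : PowerSeries ℤ) ^ x) ^ m *
      (1 + PowerSeries.X) ^ n) = dimSum m n b s := by
  have h1 : (1 + (PowerSeries.X : PowerSeries ℤ)) ^ n =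
      ∑ i ∈ range (n + 1), PowerSeries.X ^ i * PowerSeries.C (n.choose i : ℤ) := by
    rw [add_comm, add_pow]
    exact Finset.sum_congr rfl fun i _ => by simp
  rw [h1, mul_comm, Finset.sum_mul, map_sum, dimSum]
  simp only [mul_assoc, PowerSeries.coeff_X_pow_mul', PowerSeries.coeff_C_mul,
    coeff_geom_pow hm hb]
  rw [← Finset.sum_filter]
  refine Finset.sum_congr ?_ fun i hi => ?_
  · ext i
    simp only [Finset.mem_filter, Finset.mem_range]
    omega
  · have hi' : i ≤ s := by
      have := Finset.mem_range.1 hi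
      omega
    rw [tupleSum, Finset.mul_sum]
    refine Finset.sum_congr rfl fun j _ => ?_
    rw [Nat.add_sub_assoc hi']
    ring

lemma energyTuples_eq (m r k : ℕ) :
    energyTuples m r k = ↑(boundedTuples (fun _ : Fin m => r) k) := by
  ext κ
  simp only [energyTuples, Set.mem_ofPred_eq, Finset.mem_coe, mem_boundedTuples, and_comm]

lemma ncard_energyTuples {m r : ℕ} (hm : 1 ≤ m) (hr : 1 ≤ r) (k : ℕ) :
    ((energyTuples m r k).ncard : ℤ) = tupleSum m r k := by
  rw [energyTuples_eq, Set.ncard_coe_finset, card_boundedTuples, Finset.prod_const,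
    Finset.card_univ, Fintype.card_fin, coeff_geom_pow hm hr]

/-- The bound on the exponents of the monomials of `Ω_q(m|n)` truncated at `b`. -/
def expBound (m n b : ℕ) (i : Fin (m + n)) : ℕ := if i.val < m then b else 2

/-- The entries of an exponent. -/
def SuperExp.entries {m n : ℕ} (a : SuperExp m n) : Fin (m + n) → ℕ := a.1

lemma SuperExp.entries_injective {m n : ℕ} :
    Function.Injective (SuperExp.entries : SuperExp m n → Fin (m + n) → ℕ) :=
  Subtype.val_injective

lemma truncExp_eq (m n b s : ℕ) :
    SuperExp.entries '' truncExp m n b s = ↑(boundedTuples (expBound m n b) s) := by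
  ext a
  simp only [truncExp, Finset.mem_coe, mem_boundedTuples, expBound]
  constructor
  · rintro ⟨a, h, rfl⟩
    refine ⟨fun i => ?_, h.2⟩
    split_ifs with hi
    · exact h.1 i hi
    · have : a.entries i ≤ 1 := a.2 i (by omega)
      omega
  · rintro ⟨h1, h2⟩
    refine ⟨⟨a, fun i hi => ?_⟩, ⟨fun i hi => ?_, h2⟩, rfl⟩
    · have := h1 i
      rw [if_neg (by omega)] at this
      omega
    · simpa [hi] using h1 i

lemma finite_truncExp (m n b s : ℕ) : (truncExp m n b s).Finite := by
  refine Set.Finite.of_finite_image ?_ SuperExp.entries_injective.injOn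
  rw [truncExp_eq]
  exact Finset.finite_toSet _

lemma ncard_truncExp {m b : ℕ} (hm : 1 ≤ m) (hb : 1 ≤ b) (n s : ℕ) :
    ((truncExp m n b s).ncard : ℤ) = dimSum m n b s := by
  rw [← Set.ncard_image_of_injective _ SuperExp.entries_injective, truncExp_eq, Set.ncard_coe_finset,
    card_boundedTuples, Fin.prod_univ_add]
  simp only [expBound, Fin.val_castAdd, Fin.is_lt, if_true, Fin.val_natAdd,
    add_lt_iff_neg_left, not_lt_zero, if_false, Finset.prod_const, Finset.card_univ,
    Fintype.card_fin, Finset.sum_range_succ, Finset.sum_range_zero, pow_zero, pow_one, zero_add]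
  exact coeff_geom_pow_mul hm hb n s

/-! ### Configurations of particles on a line -/

lemma exists_le_sum_eq {ι : Type*} [Fintype ι] [DecidableEq ι] (c : ι → ℕ) :
    ∀ s ≤ ∑ i, c i, ∃ b : ι → ℕ, b ≤ c ∧ ∑ i, b i = s
  | 0, _ => ⟨0, fun _ => Nat.zero_le _, by simp⟩
  | s + 1, h => by
    obtain ⟨b, hb, hs⟩ := exists_le_sum_eq c s (by omega)
    obtain ⟨i, -, hi⟩ : ∃ i ∈ univ, b i < c i := Finset.exists_lt_of_sum_lt (by omega)
    refine ⟨b + Pi.single i 1, fun k => ?_, ?_⟩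
    · by_cases hk : k = i
      · subst hk
        simpa using hi
      · simpa [hk] using hb k
    · simp [Finset.sum_add_distrib, hs]

/-- Move one particle from `j` to `i`. -/
def hop {ι : Type*} [DecidableEq ι] (b : ι → ℕ) (i j : ι) : ι → ℕ :=
  fun k => b k + (if k = i then 1 else 0) - (if k = j then 1 else 0)

/-- The indices `i` and `j` are neighbours. -/
def Neighbours {N : ℕ} (i j : Fin N) : Prop := i.val + 1 = j.val ∨ j.val + 1 = i.val

/-- One particle moves to a neighbouring place that is not full. -/
def HopStep {N : ℕ} (c b b' : Fin N → ℕ) : Prop :=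
  b ≤ c ∧ ∃ i j, Neighbours i j ∧ 0 < b j ∧ b i < c i ∧ b' = hop b i j

lemma hop_le {ι : Type*} [DecidableEq ι] {c b : ι → ℕ} {i j : ι} (hb : b ≤ c) (hi : b i < c i) :
    hop b i j ≤ c := by
  intro k
  have : b k ≤ c k := hb k
  simp only [hop]
  by_cases hk : k = i
  · subst hk
    simp only [if_true]
    omega
  · simp only [hk, if_false]
    omega

/-- Let k be the neighbour of j on the way to i. If k has room, hop there and continue. If k is
full, it is nonempty because capacities are positive: first send one of its particles to i, then
refill k from j. The truncated differences add up to the distance from i to j. -/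
lemma reflTransGen_hop {N : ℕ} {c : Fin N → ℕ} (hc : ∀ i, 0 < c i) (d : ℕ) :
    ∀ (b : Fin N → ℕ) (i j : Fin N), b ≤ c → (i.val - j.val) + (j.val - i.val) = d + 1 →
      0 < b j → b i < c i → Relation.ReflTransGen (HopStep c) b (hop b i j) := by
  induction d with
  | zero =>
    intro b i j hb hd hj hi
    refine Relation.ReflTransGen.single ⟨hb, i, j, ?_, hj, hi, rfl⟩
    unfold Neighbours
    omega
  | succ d ih =>
    intro b i j hb hd hj hi
    obtain ⟨k, hk, hki⟩ : ∃ k : Fin N, Neighbours k j ∧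
        (i.val - k.val) + (k.val - i.val) = d + 1 := by
      have := i.isLt
      have := j.isLt
      unfold Neighbours
      rcases lt_or_ge i.val j.val with h | h
      · exact ⟨⟨j.val - 1, by omega⟩, Or.inl (show j.val - 1 + 1 = j.val by omega),
          show (i.val - (j.val - 1)) + (j.val - 1 - i.val) = d + 1 by omega⟩
      · exact ⟨⟨j.val + 1, by omega⟩, Or.inr rfl,
          show (i.val - (j.val + 1)) + (j.val + 1 - i.val) = d + 1 by omega⟩
    have hij : i ≠ j := by
      rintro rfl
      omega
    have hik : i ≠ k := by
      rintro rfl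
      omega
    have hjk : j ≠ k := by
      rintro rfl
      unfold Neighbours at hk
      omega
    by_cases hkc : b k < c k
    · have h1 : HopStep c b (hop b k j) := ⟨hb, k, j, hk, hj, hkc, rfl⟩
      have h2 := ih (hop b k j) i k (hop_le hb hkc) hki (by simp [hop, hjk.symm])
        (by simpa [hop, hij, hik] using hi)
      refine Relation.ReflTransGen.head h1 ?_
      convert h2 using 1
      ext x
      simp only [hop]
      split_ifs <;> simp_all
    · have hk0 : 0 < b k := by
        have := hc k
        omega
      have h1 := ih b i k hb hki hk0 hi
      have h2 : HopStep c (hop b i k) (hop (hop b i k) k j) := by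
        refine ⟨hop_le hb hi, k, j, hk, by simpa [hop, hij.symm, hjk] using hj, ?_, rfl⟩
        have : b k ≤ c k := hb k
        simp only [hop, hik.symm, if_true, if_false]
        omega
      refine Relation.ReflTransGen.tail h1 ?_
      convert h2 using 1
      ext x
      simp only [hop]
      split_ifs <;> simp_all <;> omega

lemma sum_hop {ι : Type*} [Fintype ι] [DecidableEq ι] {b : ι → ℕ} {i j : ι} (hj : 0 < b j) :
    ∑ k, hop b i j k = ∑ k, b k := by
  have h1 : ∑ k, (hop b i j k + if k = j then 1 else 0)
      = ∑ k, (b k + if k = i then 1 else 0) := by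
    refine Finset.sum_congr rfl fun k _ => ?_
    simp only [hop]
    by_cases hk : k = j
    · subst hk
      simp only [if_true]
      omega
    · simp [hk]
  rw [Finset.sum_add_distrib, Finset.sum_add_distrib] at h1
  simpa using h1

/-- Moving a particle from a place with a surplus to one with a deficit reduces the total surplus,
the truncated sum `d`, by one. -/
lemma hop_connected {N : ℕ} {c : Fin N → ℕ} (hc : ∀ i, 0 < c i) {b' : Fin N → ℕ} (hb' : b' ≤ c)
    (d : ℕ) : ∀ b : Fin N → ℕ, b ≤ c → ∑ i, b i = ∑ i, b' i → ∑ i, (b i - b' i) = d →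
      Relation.ReflTransGen (HopStep c) b b' := by
  induction d with
  | zero =>
    intro b hb hs hd
    have h1 : ∀ i ∈ univ, b i ≤ b' i := fun i hi => by
      have := (Finset.sum_eq_zero_iff.1 hd) i hi
      omega
    have h2 := (Finset.sum_eq_sum_iff_of_le h1).1 hs
    rw [show b = b' from funext fun i => h2 i (Finset.mem_univ i)]
  | succ d ih =>
    intro b hb hs hd
    obtain ⟨j, hj⟩ : ∃ j, b' j < b j := by
      by_contra! h
      rw [Finset.sum_eq_zero fun i _ => by have := h i; omega] at hd
      omega
    obtain ⟨i, hi⟩ : ∃ i, b i < b' i := by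
      by_contra! h
      exact (Finset.sum_lt_sum (fun i _ => h i) ⟨j, Finset.mem_univ j, hj⟩).ne hs.symm
    have hij : i ≠ j := by
      rintro rfl
      omega
    have hij' : i.val ≠ j.val := fun h => hij (Fin.ext h)
    have hic : b i < c i := lt_of_lt_of_le hi (hb' i)
    obtain ⟨e, he⟩ : ∃ e, (i.val - j.val) + (j.val - i.val) = e + 1 :=
      ⟨(i.val - j.val) + (j.val - i.val) - 1, by omega⟩
    refine (reflTransGen_hop hc e b i j hb he (by omega) hic).trans (ih _ (hop_le hb hic) ((sum_hop (by omega)).trans hs) ?_)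
    have h1 : ∑ k, ((hop b i j k - b' k) + if k = j then 1 else 0) = ∑ k, (b k - b' k) := by
      refine Finset.sum_congr rfl fun k _ => ?_
      simp only [hop]
      by_cases hk : k = j
      · subst hk
        simp only [hij.symm, if_true, if_false]
        omega
      · by_cases hk' : k = i
        · subst hk'
          simp only [hij, if_true, if_false]
          omega
        · simp [hk, hk']
    rw [Finset.sum_add_distrib] at h1
    simp only [Finset.sum_ite_eq', Finset.mem_univ, if_true] at h1
    omega

/-! ### Socles -/

section Socle

variable {R M : Type*} [Ring R] [AddCommGroup M] [Module R M]

lemma isSimpleModule_iff_covBy_comap (V : Submodule R M) (N : Submodule R (M ⧸ V)) :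
    IsSimpleModule R N ↔ V ⋖ N.comap V.mkQ := by
  rw [isSimpleModule_iff_isAtom, ← bot_covBy_iff,
    ← apply_covBy_apply_iff (Submodule.comapMkQRelIso V)]
  have hb : ((Submodule.comapMkQRelIso V ⊥ : Set.Ici V) : Submodule R M) = V := by
    simp [Submodule.comapMkQRelIso]
  -- The submodules above V form an order-connected set, so covering among them is covering among
  -- all submodules.
  have hr : (Set.range (OrderEmbedding.subtype (· ∈ Set.Ici V))).OrdConnected := by
    rw [show Set.range (OrderEmbedding.subtype (· ∈ Set.Ici V)) = Set.Ici V from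
      Subtype.range_coe]
    exact Set.ordConnected_Ici
  have h := Set.OrdConnected.apply_covBy_apply_iff _ hr (a := Submodule.comapMkQRelIso V ⊥)
    (b := Submodule.comapMkQRelIso V N)
  rw [← h]
  change ((Submodule.comapMkQRelIso V ⊥ : Set.Ici V) : Submodule R M) ⋖ N.comap V.mkQ ↔ _
  rw [hb]

/-- Simple submodules of M / V correspond to covers of V. This turns one step of the socle
filtration into two lattice conditions, to be checked without passing to the quotient. -/
lemma comap_socle_eq {V W : Submodule R M} (hVW : V ≤ W)
    (hle : ∀ N : Submodule R M, V ⋖ N → N ≤ W)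
    (hge : ∃ S : Set (Submodule R M), (∀ N ∈ S, V ⋖ N) ∧ W ≤ V ⊔ sSup S) :
    (socle R (M ⧸ V)).comap V.mkQ = W := by
  obtain ⟨S, hS, hW⟩ := hge
  apply le_antisymm
  · have h1 : socle R (M ⧸ V) ≤ W.map V.mkQ := by
      refine sSup_le fun N hN => ?_
      have h2 := hle _ ((isSimpleModule_iff_covBy_comap V N).1 hN)
      calc N = (N.comap V.mkQ).map V.mkQ :=
            (Submodule.map_comap_eq_of_surjective V.mkQ_surjective N).symm
        _ ≤ _ := Submodule.map_mono h2
    calc _ ≤ (W.map V.mkQ).comap V.mkQ := Submodule.comap_mono h1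
      _ = W := by rw [Submodule.comap_map_mkQ, sup_eq_right.2 hVW]
  · refine hW.trans (sup_le ?_ (sSup_le fun N hN => ?_))
    · intro x hx
      simp [(Submodule.Quotient.mk_eq_zero V).2 hx]
    · rw [← Submodule.map_le_iff_le_comap]
      refine le_sSup ((isSimpleModule_iff_covBy_comap V _).2 ?_)
      rw [Submodule.comap_map_mkQ, sup_eq_right.2 (hS N hN).le]
      exact hS N hN

lemma isSemisimpleModule_socle : IsSemisimpleModule R (socle R M) := by
  rw [socle, sSup_eq_iSup]
  exact isSemisimpleModule_biSup_of_isSemisimpleModule_submodule fun N hN =>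
    have : IsSimpleModule R N := hN
    inferInstance

instance isSemisimpleModule_loewyLayer (i : ℕ) : IsSemisimpleModule R (LoewyLayer R M i) := by
  have := isSemisimpleModule_socle (R := R) (M := M ⧸ socleFiltration R M i)
  let f : socleFiltration R M (i + 1) →ₗ[R] socle R (M ⧸ socleFiltration R M i) :=
    (socleFiltration R M i).mkQ.restrict fun _ hx => hx
  have hf : (socleFiltration R M i).submoduleOf (socleFiltration R M (i + 1)) = LinearMap.ker f := by
    ext x
    rw [LinearMap.mem_ker, ← Submodule.coe_eq_zero]
    exact (Submodule.Quotient.mk_eq_zero (socleFiltration R M i) (x := (x : M))).symm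
  let g : LoewyLayer R M i →ₗ[R] socle R (M ⧸ socleFiltration R M i) :=
    Submodule.liftQ _ f hf.le
  exact IsSemisimpleModule.of_injective g
    (LinearMap.ker_eq_bot.1 (Submodule.ker_liftQ_eq_bot _ f hf.le hf.ge))

lemma length_eq_add_one_of_covBy {V W : Submodule R M} (h : V ⋖ W) :
    Module.length R W = Module.length R V + 1 := by
  have : IsSimpleModule R (W ⧸ V.submoduleOf W) := (covBy_iff_quot_is_simple h.le).1 h
  rw [Module.length_eq_add_of_exact (Submodule.inclusion h.le)
    (Submodule.mkQ (V.submoduleOf W)) (Submodule.inclusion_injective h.le)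
    (Submodule.mkQ_surjective _), Module.length_eq_one_iff.2 this]
  rw [LinearMap.exact_iff, Submodule.ker_mkQ, Submodule.range_inclusion]
  rfl

lemma length_eq_add_length_quotient {V W : Submodule R M} (h : V ≤ W) :
    Module.length R W = Module.length R V + Module.length R (W ⧸ V.submoduleOf W) := by
  refine Module.length_eq_add_of_exact (Submodule.inclusion h)
    (Submodule.mkQ (V.submoduleOf W)) (Submodule.inclusion_injective h)
    (Submodule.mkQ_surjective _) ?_
  rw [LinearMap.exact_iff, Submodule.ker_mkQ, Submodule.range_inclusion]
  rfl

end Socle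

/-! ### Quantum integers at a root of unity -/

section RootOfUnity

variable {K : Type*} [Field K] {q : K} {ℓ : ℕ}

lemma QCharEq.sub_inv_ne_zero (hq : QCharEq q ℓ) (hℓ : 3 ≤ ℓ) : q - q⁻¹ ≠ 0 := by
  intro h
  -- If q = q⁻¹, division by zero makes [1] = 0.
  have h1 : ℓ ≤ 1 := hq.2 ⟨one_pos, by simp [qInt, h]⟩
  omega

lemma QCharEq.ne_zero (hq : QCharEq q ℓ) (hℓ : 3 ≤ ℓ) : q ≠ 0 := by
  rintro rfl
  exact hq.sub_inv_ne_zero hℓ (by simp)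

lemma QCharEq.ne_one (hq : QCharEq q ℓ) (hℓ : 3 ≤ ℓ) : q ≠ 1 := by
  rintro rfl
  exact hq.sub_inv_ne_zero hℓ (by simp)

lemma QCharEq.qInt_eq_zero_iff_pow (hq : QCharEq q ℓ) (hℓ : 3 ≤ ℓ) (k : ℕ) :
    qInt q k = 0 ↔ (q ^ 2) ^ k = 1 := by
  have h0 : q ^ k ≠ 0 := pow_ne_zero _ (hq.ne_zero hℓ)
  rw [qInt, div_eq_zero_iff, or_iff_left (hq.sub_inv_ne_zero hℓ), sub_eq_zero,
    ← mul_eq_one_iff_eq_inv₀ h0, ← pow_mul, mul_comm 2 k, pow_mul, sq]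

/-- The order of q itself may be ℓ or 2ℓ, so arguments about divisibility by ℓ go through q². -/
lemma QCharEq.orderOf_sq (hq : QCharEq q ℓ) (hℓ : 3 ≤ ℓ) : orderOf (q ^ 2) = ℓ := by
  rw [orderOf_eq_iff (by omega)]
  refine ⟨(hq.qInt_eq_zero_iff_pow hℓ ℓ).1 hq.1.2, fun k hk hk0 h => ?_⟩
  have := hq.2 ⟨hk0, (hq.qInt_eq_zero_iff_pow hℓ k).2 h⟩
  omega

lemma QCharEq.qInt_eq_zero_iff (hq : QCharEq q ℓ) (hℓ : 3 ≤ ℓ) (k : ℕ) :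
    qInt q k = 0 ↔ ℓ ∣ k := by
  rw [hq.qInt_eq_zero_iff_pow hℓ, ← orderOf_dvd_iff_pow_eq_one, hq.orderOf_sq hℓ]

lemma QCharEq.mod_eq_of_pow_eq (hq : QCharEq q ℓ) (hℓ : 3 ≤ ℓ) {a b : ℕ} (h : q ^ a = q ^ b) :
    a % ℓ = b % ℓ := by
  have h1 : (Units.mk0 q (hq.ne_zero hℓ) ^ 2) ^ a = (Units.mk0 q (hq.ne_zero hℓ) ^ 2) ^ b := by
    ext
    push_cast
    rw [Units.val_mk0, ← pow_mul, ← pow_mul, mul_comm 2, mul_comm 2, pow_mul, pow_mul, h]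
  rw [pow_eq_pow_iff_modEq, ← orderOf_units] at h1
  push_cast at h1
  rw [Units.val_mk0, hq.orderOf_sq hℓ] at h1
  exact h1

lemma QCharEq.eq_of_inv_pow_eq (hq : QCharEq q ℓ) (hℓ : 3 ≤ ℓ) {a b : ℕ} (ha : a ≤ 1) (hb : b ≤ 1)
    (h : q⁻¹ ^ a = q⁻¹ ^ b) : a = b := by
  have h1 : q⁻¹ ≠ 1 := by simpa using hq.ne_one hℓ
  interval_cases a <;> interval_cases b <;> simp_all

end RootOfUnity

/-! ### Digits of exponents -/

section Digits

variable {m n : ℕ}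

@[ext]
lemma SuperExp.ext {a b : SuperExp m n} (h : ∀ k, a.1 k = b.1 k) : a = b :=
  Subtype.ext (funext h)

/-- The quotients of the even entries by `ℓ`. -/
def SuperExp.quot (ℓ : ℕ) (a : SuperExp m n) : Fin m → ℕ := fun j => a.1 (Fin.castAdd n j) / ℓ

/-- The remainders of the even entries modulo `ℓ`, together with the odd entries. -/
def SuperExp.res (ℓ : ℕ) (a : SuperExp m n) : Fin (m + n) → ℕ :=
  fun k => if k.val < m then a.1 k % ℓ else a.1 k

/-- The tuple with quotients `κ` and residues `b`. -/
def combine (ℓ : ℕ) (κ : Fin m → ℕ) (b : Fin (m + n) → ℕ) : Fin (m + n) → ℕ :=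
  fun k => (if h : k.val < m then κ ⟨k.val, h⟩ else 0) * ℓ + b k

/-- The largest residues. -/
def resBound (m n ℓ : ℕ) : Fin (m + n) → ℕ := fun k => if k.val < m then ℓ - 1 else 1

lemma energy_eq (ℓ : ℕ) (a : SuperExp m n) : energy ℓ a = ∑ j, a.quot ℓ j := rfl

lemma SuperExp.eq_combine (ℓ : ℕ) (a : SuperExp m n) : a.1 = combine ℓ (a.quot ℓ) (a.res ℓ) := by
  ext k
  simp only [combine, quot, res]
  split_ifs with h
  · exact (Nat.div_add_mod' _ _).symm
  · simp

lemma SuperExp.res_le {ℓ : ℕ} (hℓ : 3 ≤ ℓ) (a : SuperExp m n) : a.res ℓ ≤ resBound m n ℓ := by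
  intro k
  simp only [res, resBound]
  split_ifs with h
  · have := Nat.mod_lt (a.1 k) (show 0 < ℓ by omega)
    omega
  · exact a.2 k (by omega)

lemma SuperExp.eq_of_quot_res {ℓ : ℕ} {a b : SuperExp m n} (h1 : a.quot ℓ = b.quot ℓ)
    (h2 : a.res ℓ = b.res ℓ) : a = b :=
  Subtype.ext (by rw [a.eq_combine ℓ, b.eq_combine ℓ, h1, h2])

lemma sum_combine (ℓ : ℕ) (κ : Fin m → ℕ) (b : Fin (m + n) → ℕ) :
    ∑ k, combine ℓ κ b k = (∑ j, κ j) * ℓ + ∑ k, b k := by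
  simp only [combine, Finset.sum_add_distrib, ← Finset.sum_mul]
  rw [Fin.sum_univ_add]
  simp

lemma SuperExp.sum_eq (ℓ : ℕ) (a : SuperExp m n) :
    ∑ k, a.1 k = energy ℓ a * ℓ + ∑ k, a.res ℓ k := by
  rw [energy_eq, ← sum_combine, ← a.eq_combine]

/-- The exponent with quotients `κ` and residues `b`. -/
def combineExp {ℓ : ℕ} (κ : Fin m → ℕ) {b : Fin (m + n) → ℕ} (hb : b ≤ resBound m n ℓ) :
    SuperExp m n :=
  ⟨combine ℓ κ b, fun i hi => by
    have h : b i ≤ resBound m n ℓ i := hb i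
    simp only [combine, resBound, show ¬ i.val < m by omega, if_false, dif_neg, not_false_eq_true]
      at h ⊢
    omega⟩

lemma quot_of_eq_combine {ℓ : ℕ} (hℓ : 3 ≤ ℓ) {κ : Fin m → ℕ} {b : Fin (m + n) → ℕ}
    (hb : b ≤ resBound m n ℓ) {a : SuperExp m n} (ha : a.1 = combine ℓ κ b) : a.quot ℓ = κ := by
  ext j
  have h : b (Fin.castAdd n j) ≤ resBound m n ℓ (Fin.castAdd n j) := hb _
  simp only [resBound, Fin.val_castAdd, Fin.is_lt, if_true] at h
  simp only [SuperExp.quot, ha, combine, Fin.val_castAdd, Fin.is_lt, dif_pos]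
  rw [mul_comm, Nat.mul_add_div (by omega), Nat.div_eq_of_lt (by omega), add_zero]

lemma res_of_eq_combine {ℓ : ℕ} (hℓ : 3 ≤ ℓ) {κ : Fin m → ℕ} {b : Fin (m + n) → ℕ}
    (hb : b ≤ resBound m n ℓ) {a : SuperExp m n} (ha : a.1 = combine ℓ κ b) : a.res ℓ = b := by
  ext k
  have h : b k ≤ resBound m n ℓ k := hb _
  simp only [resBound] at h
  simp only [SuperExp.res, ha, combine]
  split_ifs with hk
  · rw [if_pos hk] at h
    rw [mul_comm, Nat.mul_add_mod, Nat.mod_eq_of_lt (by omega)]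
  · simp

lemma sum_resBound (m n ℓ : ℕ) : ∑ k, resBound m n ℓ k = m * (ℓ - 1) + n := by
  rw [Fin.sum_univ_add]
  simp [resBound]

lemma resBound_pos {ℓ : ℕ} (hℓ : 3 ≤ ℓ) (k : Fin (m + n)) : 0 < resBound m n ℓ k := by
  unfold resBound
  split_ifs <;> omega

lemma mem_truncExp_iff {ℓ : ℕ} (hℓ : 3 ≤ ℓ) {r s : ℕ} {a : SuperExp m n} :
    a ∈ truncExp m n (r * ℓ) s ↔
      (∀ j, a.quot ℓ j < r) ∧ energy ℓ a * ℓ + ∑ k, a.res ℓ k = s := by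
  rw [← SuperExp.sum_eq]
  refine and_congr_left fun _ => ⟨fun h j => ?_, fun h i hi => ?_⟩
  · rw [SuperExp.quot, Nat.div_lt_iff_lt_mul (by omega)]
    exact h _ j.2
  · have := h ⟨i, hi⟩
    rwa [SuperExp.quot, Nat.div_lt_iff_lt_mul (by omega)] at this

/-- Without a carry at i the quotient there does not grow, and removing a unit at j can only borrow.
-/
lemma quot_shift_le {ℓ : ℕ} {a : SuperExp m n} {i j : Fin (m + n)}
    (h : 0 < a.1 j ∧ (m ≤ i.val → a.1 i = 0)) (hi : i.val < m → ¬ ℓ ∣ a.1 i + 1) :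
    (a.shift i j h).quot ℓ ≤ a.quot ℓ := by
  intro k
  simp only [SuperExp.quot, SuperExp.shift]
  by_cases hk : Fin.castAdd n k = i
  · subst hk
    rw [← Nat.succ_div_of_not_dvd (hi (by simp))]
    exact Nat.div_le_div_right (by simp)
  · simp only [hk, if_false]
    exact Nat.div_le_div_right (by simp)

end Digits

/-! ### Coefficients and spans of monomials -/

section Spans

variable {K : Type*} [Field K] {m n : ℕ}

lemma mem_monoSpan_iff {S : Set (SuperExp m n)} {x : Grassmann K m n} :
    x ∈ monoSpan K S ↔ ∀ a, (monoBasis K m n).repr x a ≠ 0 → a ∈ S := by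
  have := (monoBasis K m n).mem_span_image (m := x) (s := S)
  exact this.trans ⟨fun h a ha => h (by simpa using ha), fun h a ha => h a (by simpa using ha)⟩

lemma repr_mono (a : SuperExp m n) :
    (monoBasis K m n).repr (mono K a) = Finsupp.single a 1 :=
  (monoBasis K m n).repr_self a

lemma mono_mem_monoSpan {S : Set (SuperExp m n)} {a : SuperExp m n} :
    mono K a ∈ monoSpan K S ↔ a ∈ S := by
  classical
  rw [mem_monoSpan_iff]
  simp [repr_mono, Finsupp.single_apply]

lemma monoSpan_le_iff {S : Set (SuperExp m n)} {N : Submodule K (Grassmann K m n)} :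
    monoSpan K S ≤ N ↔ ∀ a ∈ S, mono K a ∈ N := by
  rw [monoSpan, Submodule.span_le, Set.image_subset_iff]
  rfl

lemma monoSpan_mono {S T : Set (SuperExp m n)} (h : S ⊆ T) : monoSpan K S ≤ monoSpan K T :=
  Submodule.span_mono (Set.image_mono h)

lemma finrank_monoSpan (S : Set (SuperExp m n)) : Module.finrank K (monoSpan K S) = S.ncard := by
  have h1 : LinearIndependent K fun a : S => mono K a.1 :=
    (monoBasis K m n).linearIndependent.comp _ Subtype.val_injective
  have h2 : monoSpan K S = Submodule.span K (Set.range fun a : S => mono K a.1) := by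
    rw [monoSpan, Set.image_eq_range]
  rw [h2, Module.finrank_eq_nat_card_basis (Module.Basis.span h1)]
  rfl

end Spans

/-! ### The action on monomials -/

section Action

variable {K : Type*} [Field K] {q : K} {ℓ m n : ℕ}

lemma moveOp_mono (q : K) (i j : Fin (m + n)) (a : SuperExp m n)
    (h : 0 < a.1 j ∧ (m ≤ i.val → a.1 i = 0)) :
    moveOp q i j (mono K a) =
      (if i.val < m then qInt q (a.1 i + 1) else 1) • mono K (a.shift i j h) := by
  rw [moveOp, mono, Module.Basis.constr_basis, dif_pos h]

lemma moveOp_mono_of_not (q : K) (i j : Fin (m + n)) (a : SuperExp m n)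
    (h : ¬ (0 < a.1 j ∧ (m ≤ i.val → a.1 i = 0))) : moveOp q i j (mono K a) = 0 := by
  rw [moveOp, mono, Module.Basis.constr_basis, dif_neg h]

lemma moveOp_mem_quantumAction (q : K) {i j : Fin (m + n)} (h : Neighbours i j) :
    moveOp q i j ∈ quantumAction q m n := by
  refine Algebra.subset_adjoin (Or.inl ?_)
  obtain ⟨i, hi⟩ := i
  obtain ⟨j, hj⟩ := j
  rcases h with h | h
  · obtain rfl : i + 1 = j := h
    exact ⟨i, hj, Or.inl rfl⟩
  · obtain rfl : j + 1 = i := h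
    exact ⟨j, hi, Or.inr rfl⟩

/-- The eigenvalue of `K_i` on `x^a`. -/
def weight (q : K) (i : Fin (m + n)) (a : SuperExp m n) : K :=
  if i.val < m then q ^ a.1 i else q⁻¹ ^ a.1 i

lemma kOp_mono (q : K) (i : Fin (m + n)) (a : SuperExp m n) :
    kOp q i (mono K a) = weight q i a • mono K a := by
  rw [kOp, mono, Module.Basis.constr_basis]
  rfl

/-- The monomials `x^a` and `x^b` have the same weight. -/
def SameWeight (q : K) (a b : SuperExp m n) : Prop := ∀ i, weight q i b = weight q i a

/-- Only this direction is used. The converse can fail: if q has order 2ℓ, weights also see parities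
of quotients. -/
lemma res_eq_of_sameWeight (hℓ : 3 ≤ ℓ) (hq : QCharEq q ℓ) {a b : SuperExp m n}
    (h : SameWeight q a b) : b.res ℓ = a.res ℓ := by
  ext k
  have hk := h k
  simp only [weight, SuperExp.res] at hk ⊢
  split_ifs at hk ⊢ with hkm
  · exact hq.mod_eq_of_pow_eq hℓ hk
  · exact hq.eq_of_inv_pow_eq hℓ (b.2 k (by omega)) (a.2 k (by omega)) hk

/-- Lagrange interpolation in the commuting diagonal operators K_i: each member of F contributes a
linear factor that is 0 on it and 1 on the weight of `a₀`. -/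
lemma exists_separating (q : K) (a₀ : SuperExp m n) (F : Finset (SuperExp m n))
    (hF : ∀ a ∈ F, ¬ SameWeight q a₀ a) :
    ∃ T ∈ quantumAction q m n, ∃ t : SuperExp m n → K, (∀ a, T (mono K a) = t a • mono K a) ∧
      (∀ a, SameWeight q a₀ a → t a = 1) ∧ ∀ a ∈ F, t a = 0 := by
  classical
  induction F using Finset.induction_on with
  | empty =>
    exact ⟨1, Subalgebra.one_mem _, fun _ => 1, fun a => by simp, fun _ _ => rfl, by simp⟩
  | insert b F _ ih =>
    obtain ⟨T, hT, t, h1, h2, h3⟩ := ih fun a ha => hF a (Finset.mem_insert_of_mem ha)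
    obtain ⟨i, hi⟩ := not_forall.1 (hF b (Finset.mem_insert_self _ _))
    have hi' : weight q i a₀ - weight q i b ≠ 0 := sub_ne_zero.2 (Ne.symm hi)
    let D : Module.End K (Grassmann K m n) := (weight q i a₀ - weight q i b)⁻¹ •
      (kOp q i - algebraMap K _ (weight q i b))
    have hk : kOp q i ∈ quantumAction q m n := Algebra.subset_adjoin (Or.inr ⟨i, Or.inl rfl⟩)
    have hD : D ∈ quantumAction q m n :=
      Subalgebra.smul_mem _ (sub_mem hk (Subalgebra.algebraMap_mem _ _)) _
    refine ⟨D * T, Subalgebra.mul_mem _ hD hT,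
      fun a => (weight q i a₀ - weight q i b)⁻¹ * (weight q i a - weight q i b) * t a,
      fun a => ?_, fun a ha => ?_, fun a ha => ?_⟩
    · rw [Module.End.mul_apply, h1, map_smul]
      simp only [D, LinearMap.smul_apply, LinearMap.sub_apply, kOp_mono,
        Module.algebraMap_end_apply, ← sub_smul, smul_smul]
      congr 1
      ring
    · beta_reduce
      rw [h2 a ha, ha i, inv_mul_cancel₀ hi', one_mul]
    · rcases Finset.mem_insert.1 ha with rfl | ha
      · simp
      · simp [h3 a ha]

lemma repr_of_diagonal {T : Module.End K (Grassmann K m n)} {t : SuperExp m n → K}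
    (h : ∀ a, T (mono K a) = t a • mono K a) (x : Grassmann K m n) (a : SuperExp m n) :
    (monoBasis K m n).repr (T x) a = t a * (monoBasis K m n).repr x a := by
  classical
  have h1 : (Finsupp.lapply a ∘ₗ (monoBasis K m n).repr.toLinearMap) ∘ₗ T =
      t a • (Finsupp.lapply a ∘ₗ (monoBasis K m n).repr.toLinearMap) := by
    refine (monoBasis K m n).ext fun b => ?_
    change (monoBasis K m n).repr (T (mono K b)) a = t a * (monoBasis K m n).repr (mono K b) a
    rw [h, map_smul, repr_mono, Finsupp.smul_apply, Finsupp.single_apply]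
    split_ifs with hb
    · rw [hb, smul_eq_mul]
    · simp
  exact LinearMap.congr_fun h1 x

lemma exists_weight_projection (q : K) (a₀ : SuperExp m n) (x : Grassmann K m n) :
    ∃ T ∈ quantumAction q m n, ∀ a,
      (SameWeight q a₀ a → (monoBasis K m n).repr (T x) a = (monoBasis K m n).repr x a) ∧
      (¬ SameWeight q a₀ a → (monoBasis K m n).repr (T x) a = 0) := by
  classical
  obtain ⟨T, hT, t, h1, h2, h3⟩ := exists_separating q a₀
    (((monoBasis K m n).repr x).support.filter fun a => ¬ SameWeight q a₀ a)
    fun a ha => (Finset.mem_filter.1 ha).2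
  refine ⟨T, hT, fun a => ⟨fun ha => ?_, fun ha => ?_⟩⟩
  · rw [repr_of_diagonal h1, h2 a ha, one_mul]
  · rw [repr_of_diagonal h1]
    by_cases hx : (monoBasis K m n).repr x a = 0
    · rw [hx, mul_zero]
    · rw [h3 a (Finset.mem_filter.2 ⟨Finsupp.mem_support_iff.2 hx, ha⟩), zero_mul]

/-- The operator `T` sends `x^{κℓ + b}` to a nonzero multiple of `x^{κℓ + b'}` for all `κ`. -/
def MovesRes (ℓ : ℕ) (T : Module.End K (Grassmann K m n)) (b b' : Fin (m + n) → ℕ) : Prop :=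
  ∀ (κ : Fin m → ℕ) (a a' : SuperExp m n), a.1 = combine ℓ κ b → a'.1 = combine ℓ κ b' →
    ∃ c : K, c ≠ 0 ∧ T (mono K a) = c • mono K a'

lemma not_dvd_of_eq_combine {κ : Fin m → ℕ} {b : Fin (m + n) → ℕ} {a : SuperExp m n}
    (ha : a.1 = combine ℓ κ b) {i : Fin (m + n)} (hi : b i < resBound m n ℓ i) (him : i.val < m) :
    ¬ ℓ ∣ a.1 i + 1 := by
  intro h
  rw [ha, combine, add_assoc, Nat.dvd_add_right (dvd_mul_left _ _)] at h
  simp only [resBound, him, if_true] at hi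
  have := Nat.le_of_dvd (by omega) h
  omega

/-- The residue at i is not maximal and that at j is positive, so there is neither carry nor borrow,
and the coefficient is nonzero whatever κ is. -/
lemma exists_movesRes_of_hopStep (hℓ : 3 ≤ ℓ) (hq : QCharEq q ℓ) {b b' : Fin (m + n) → ℕ}
    (h : HopStep (resBound m n ℓ) b b') : ∃ T ∈ quantumAction q m n, MovesRes ℓ T b b' := by
  obtain ⟨_, i, j, hij, hj, hi, rfl⟩ := h
  refine ⟨moveOp q i j, moveOp_mem_quantumAction q hij, fun κ a a' ha ha' => ?_⟩
  have h1 : 0 < a.1 j ∧ (m ≤ i.val → a.1 i = 0) := by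
    refine ⟨?_, fun h => ?_⟩
    · rw [ha, combine]
      omega
    · simp only [resBound, show ¬ i.val < m by omega, if_false] at hi
      simp only [ha, combine, show ¬ i.val < m by omega, dif_neg, not_false_eq_true]
      omega
  refine ⟨if i.val < m then qInt q (a.1 i + 1) else 1, ?_, (moveOp_mono q i j a h1).trans ?_⟩
  · split_ifs with him
    · rw [Ne, hq.qInt_eq_zero_iff hℓ]
      exact not_dvd_of_eq_combine ha hi him
    · exact one_ne_zero
  · congr 2
    ext k
    simp only [SuperExp.shift, ha, ha', combine, hop]
    by_cases hkj : k = j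
    · subst hkj
      simp only [if_true]
      omega
    · simp only [hkj, if_false]
      omega

lemma exists_movesRes (hℓ : 3 ≤ ℓ) (hq : QCharEq q ℓ) {b b' : Fin (m + n) → ℕ}
    (hb : b ≤ resBound m n ℓ) (hb' : b' ≤ resBound m n ℓ) (hs : ∑ k, b k = ∑ k, b' k) :
    ∃ T ∈ quantumAction q m n, MovesRes ℓ T b b' := by
  have h := hop_connected (resBound_pos hℓ) hb' _ b hb hs rfl
  clear hb' hs
  induction h with
  | refl =>
    refine ⟨1, Subalgebra.one_mem _, fun κ a a' ha ha' => ⟨1, one_ne_zero, ?_⟩⟩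
    rw [show a = a' from Subtype.ext (ha.trans ha'.symm), one_smul, Module.End.one_apply]
  | tail _ h ih =>
    obtain ⟨T, hT, h1⟩ := ih
    obtain ⟨T', hT', h2⟩ := exists_movesRes_of_hopStep hℓ hq h
    refine ⟨T' * T, Subalgebra.mul_mem _ hT' hT, fun κ a a' ha ha' => ?_⟩
    obtain ⟨c, hc, h3⟩ := h1 κ a (combineExp κ h.1) ha rfl
    obtain ⟨d, hd, h4⟩ := h2 κ (combineExp κ h.1) a' rfl ha'
    refine ⟨c * d, mul_ne_zero hc hd, ?_⟩
    rw [Module.End.mul_apply, h3, map_smul, h4, smul_smul]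

/-- Emptying site j and keeping one free place at a neighbour i costs (ℓ - 1) + 1 = ℓ places, which
is the slack in `hs`. One more hop from j to i then turns κ_j ℓ into (κ_j - 1)ℓ + (ℓ - 1), or gives
zero if κ_j = 0. A single operator must serve all κ, since it is later applied to a combination of
monomials with common residues. -/
lemma exists_lowering (hm : 2 ≤ m) (hℓ : 3 ≤ ℓ) (hq : QCharEq q ℓ) {b : Fin (m + n) → ℕ}
    (hb : b ≤ resBound m n ℓ) (hs : ∑ k, b k + ℓ ≤ m * (ℓ - 1) + n) (j : Fin m) :
    ∃ T ∈ quantumAction q m n, ∃ b' ≤ resBound m n ℓ, ∀ (κ : Fin m → ℕ) (a : SuperExp m n),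
      a.1 = combine ℓ κ b →
        (κ j = 0 → T (mono K a) = 0) ∧
        (0 < κ j → ∃ (c : K) (a' : SuperExp m n), c ≠ 0 ∧
          a'.1 = combine ℓ (Function.update κ j (κ j - 1)) b' ∧ T (mono K a) = c • mono K a') := by
  -- A neighbour exists even for n = 0, because m ≥ 2.
  obtain ⟨i, hi⟩ : ∃ i : Fin (m + n), Neighbours i (Fin.castAdd n j) := by
    have := j.2
    by_cases hj : j.val = 0
    · exact ⟨⟨1, by omega⟩, Or.inr (by simp [hj])⟩
    · exact ⟨⟨j.val - 1, by omega⟩, Or.inl (show j.val - 1 + 1 = j.val by omega)⟩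
  set j' := Fin.castAdd n j with hj'
  have hjm : j'.val < m := j.2
  have hij : i ≠ j' := by
    rintro rfl
    unfold Neighbours at hi
    omega
  have hpos := resBound_pos (m := m) (n := n) hℓ i
  -- the largest residues with an empty place `j'` and room at `i`
  obtain ⟨b₁, hb₁, hs₁⟩ := exists_le_sum_eq
    (fun k => if k = j' then 0 else if k = i then resBound m n ℓ i - 1 else resBound m n ℓ k)
    (∑ k, b k) (by
      have h1 : ∑ k, ((if k = j' then 0 else if k = i then resBound m n ℓ i - 1
          else resBound m n ℓ k) + ((if k = j' then ℓ - 1 else 0) + if k = i then 1 else 0)) =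
          ∑ k, resBound m n ℓ k := by
        refine Finset.sum_congr rfl fun k _ => ?_
        by_cases hk : k = j'
        · rw [hk]
          simp [hij.symm, resBound, hjm]
        · by_cases hk' : k = i
          · rw [hk']
            simp only [hij, if_true, if_false]
            omega
          · simp [hk, hk']
      rw [sum_resBound, Finset.sum_add_distrib, Finset.sum_add_distrib] at h1
      simp only [Finset.sum_ite_eq', Finset.mem_univ, if_true] at h1
      omega)
  have hb₁' : b₁ ≤ resBound m n ℓ := by
    intro k
    change b₁ k ≤ resBound m n ℓ k
    have h : b₁ k ≤ if k = j' then 0 else if k = i then resBound m n ℓ i - 1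
      else resBound m n ℓ k := hb₁ k
    split_ifs at h with h1 h2
    · omega
    · rw [h2] at h ⊢
      omega
    · exact h
  have hj0 : b₁ j' = 0 := by simpa using hb₁ j'
  have hi1 : b₁ i < resBound m n ℓ i := by
    have := hb₁ i
    simp only [hij, if_true, if_false] at this
    omega
  obtain ⟨T, hT, h1⟩ := exists_movesRes hℓ hq hb hb₁' hs₁.symm
  refine ⟨moveOp q i j' * T, Subalgebra.mul_mem _ (moveOp_mem_quantumAction q hi) hT,
    fun k => if k = j' then ℓ - 1 else if k = i then b₁ i + 1 else b₁ k, ?_, fun κ a ha => ?_⟩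
  · intro k
    by_cases hk : k = j'
    · rw [hk]
      simp [resBound, hjm]
    · by_cases hk' : k = i
      · rw [hk']
        simp only [hij, if_true, if_false]
        omega
      · simpa [hk, hk'] using hb₁' k
  obtain ⟨c, hc, h2⟩ := h1 κ a (combineExp κ hb₁') ha rfl
  have hcomb : ∀ k, (combineExp κ hb₁' : SuperExp m n).1 k = combine ℓ κ b₁ k := fun _ => rfl
  have hcj : (combineExp κ hb₁' : SuperExp m n).1 j' = κ j * ℓ := by
    rw [hcomb, combine, hj0, dif_pos hjm, add_zero]
    rfl
  refine ⟨fun h0 => ?_, fun h0 => ?_⟩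
  · rw [Module.End.mul_apply, h2, map_smul, moveOp_mono_of_not, smul_zero]
    rw [hcj, h0]
    simp
  · have h3 : 0 < (combineExp κ hb₁' : SuperExp m n).1 j' ∧
        (m ≤ i.val → (combineExp κ hb₁' : SuperExp m n).1 i = 0) := by
      refine ⟨?_, fun h => ?_⟩
      · rw [hcj]
        positivity
      · simp only [resBound, show ¬ i.val < m by omega, if_false] at hi1
        simp only [hcomb, combine, show ¬ i.val < m by omega, dif_neg, not_false_eq_true]
        omega
    refine ⟨c * (if i.val < m then qInt q ((combineExp κ hb₁' : SuperExp m n).1 i + 1) else 1),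
      (combineExp κ hb₁').shift i j' h3, mul_ne_zero hc ?_, ?_, ?_⟩
    · split_ifs with him
      · rw [Ne, hq.qInt_eq_zero_iff hℓ]
        exact not_dvd_of_eq_combine rfl hi1 him
      · exact one_ne_zero
    · ext k
      simp only [SuperExp.shift, hcomb]
      by_cases hk : k = j'
      · subst hk
        obtain ⟨x, hx⟩ : ∃ x, κ j = x + 1 := ⟨κ j - 1, by omega⟩
        have hjj : (⟨j'.val, hjm⟩ : Fin m) = j := rfl
        simp only [combine, hj0, dif_pos hjm, hij.symm, if_true, if_false, hjj,
          Function.update_self, hx, Nat.add_mul, one_mul, Nat.add_sub_cancel]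
        omega
      · have hk2 : ∀ h : k.val < m, (⟨k.val, h⟩ : Fin m) ≠ j := by
          rintro h rfl
          exact hk rfl
        have hu : (if h : k.val < m then Function.update κ j (κ j - 1) ⟨k.val, h⟩ else 0) =
            if h : k.val < m then κ ⟨k.val, h⟩ else 0 := by
          split_ifs with h
          · rw [Function.update_of_ne (hk2 h)]
          · rfl
        simp only [combine, hu, hk, if_false]
        by_cases hk' : k = i
        · subst hk'
          simp only [if_true]
          omega
        · simp only [hk', if_false]
          omega
    · rw [Module.End.mul_apply, h2, map_smul, moveOp_mono q i j' _ h3, smul_smul]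

end Action

noncomputable section

/-! ### Submodules given by sets of quotients -/

/-- The exponents of `Ω_q^{(s)}(m|n, 𝐫)` with quotients in `D`. -/
def quotSet (ℓ r s : ℕ) {m : ℕ} (n : ℕ) (D : LowerSet (Fin m → ℕ)) : Set (SuperExp m n) :=
  {a | a ∈ truncExp m n (r * ℓ) s ∧ a.quot ℓ ∈ D}

/-- The tuples with sum less than `E`. -/
def sumLower (m E : ℕ) : LowerSet (Fin m → ℕ) where
  carrier := {κ | ∑ j, κ j < E}
  lower' := fun _ _ h h1 => lt_of_le_of_lt (Finset.sum_le_sum fun j _ => h j) h1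

/-- The tuples with sum less than `E`, and those with sum `E` in `C`. -/
def blockLower {m : ℕ} (E : ℕ) (C : Set (Fin m → ℕ)) : LowerSet (Fin m → ℕ) where
  carrier := {κ | ∑ j, κ j < E ∨ (∑ j, κ j = E ∧ κ ∈ C)}
  lower' := by
    rintro κ κ' h h1
    have hle : ∑ j, κ' j ≤ ∑ j, κ j := Finset.sum_le_sum fun j _ => h j
    rcases h1 with h1 | ⟨h1, h2⟩
    · exact Or.inl (lt_of_le_of_lt hle h1)
    · rcases hle.lt_or_eq with h3 | h3
      · exact Or.inl (h3.trans_eq h1)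
      · have h4 : κ' = κ :=
          funext fun j => (Finset.sum_eq_sum_iff_of_le fun j _ => h j).1 h3 j (Finset.mem_univ j)
        exact Or.inr ⟨h3.trans h1, h4 ▸ h2⟩

section QuotSpan

variable {K : Type*} [Field K] {q : K} {ℓ m n r s : ℕ}

lemma mem_sumLower {E : ℕ} {κ : Fin m → ℕ} : κ ∈ sumLower m E ↔ ∑ j, κ j < E := Iff.rfl

lemma mem_blockLower {E : ℕ} {C : Set (Fin m → ℕ)} {κ : Fin m → ℕ} :
    κ ∈ blockLower E C ↔ ∑ j, κ j < E ∨ (∑ j, κ j = E ∧ κ ∈ C) := Iff.rfl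

lemma moveOp_mem_quotSet (hℓ : 3 ≤ ℓ) (hq : QCharEq q ℓ) (D : LowerSet (Fin m → ℕ))
    (i j : Fin (m + n)) {x : Grassmann K m n} (hx : x ∈ monoSpan K (quotSet ℓ r s n D)) :
    moveOp q i j x ∈ monoSpan K (quotSet ℓ r s n D) := by
  suffices h : monoSpan K (quotSet ℓ r s n D) ≤
      (monoSpan K (quotSet ℓ r s n D)).comap (moveOp q i j) from h hx
  rw [monoSpan_le_iff]
  intro a ha
  rw [Submodule.mem_comap]
  have h1 := moveOp_mem (qInt_mul_eq_zero hq.1.2 r) i j (mono_mem_monoSpan (K := K).2 ha.1)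
  by_cases h : 0 < a.1 j ∧ (m ≤ i.val → a.1 i = 0)
  · rw [moveOp_mono q i j a h] at h1 ⊢
    by_cases hc : (if i.val < m then qInt q (a.1 i + 1) else 1) = 0
    · rw [hc, zero_smul]
      exact Submodule.zero_mem _
    · refine Submodule.smul_mem _ _ (mono_mem_monoSpan.2 ⟨?_, ?_⟩)
      · exact mono_mem_monoSpan.1 ((Submodule.smul_mem_iff _ hc).1 h1)
      · refine D.lower (quot_shift_le h fun him => ?_) ha.2
        rwa [if_pos him, hq.qInt_eq_zero_iff hℓ] at hc
  · rw [moveOp_mono_of_not q i j a h]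
    exact Submodule.zero_mem _

lemma quantumAction_mem_quotSet (hℓ : 3 ≤ ℓ) (hq : QCharEq q ℓ) (D : LowerSet (Fin m → ℕ))
    {T : Module.End K (Grassmann K m n)} (hT : T ∈ quantumAction q m n)
    {x : Grassmann K m n} (hx : x ∈ monoSpan K (quotSet ℓ r s n D)) :
    T x ∈ monoSpan K (quotSet ℓ r s n D) := by
  refine Algebra.adjoin_induction (p := fun T _ => ∀ x ∈ monoSpan K (quotSet ℓ r s n D),
    T x ∈ monoSpan K (quotSet ℓ r s n D)) ?_ ?_ ?_ ?_ hT x hx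
  · rintro T (⟨i, hi, rfl | rfl⟩ | ⟨i, rfl | rfl⟩) x hx
    · exact moveOp_mem_quotSet hℓ hq D _ _ hx
    · exact moveOp_mem_quotSet hℓ hq D _ _ hx
    · exact kOp_mem _ hx
    · exact kOp_mem _ hx
  · intro c x hx
    rw [Module.algebraMap_end_apply]
    exact Submodule.smul_mem _ _ hx
  · intro S T _ _ h1 h2 x hx
    exact Submodule.add_mem _ (h1 x hx) (h2 x hx)
  · intro S T _ _ h1 h2 x hx
    exact h1 _ (h2 x hx)

/-- The submodule spanned by the monomials of `Ω_q^{(s)}(m|n, 𝐫)` with quotients in `D`. -/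
def quotSpan (hℓ : 3 ≤ ℓ) (hq : QCharEq q ℓ) (n r s : ℕ) (D : LowerSet (Fin m → ℕ)) :
    Submodule (quantumAction q m n) (Grassmann K m n) where
  carrier := monoSpan K (quotSet ℓ r s n D)
  add_mem' := Submodule.add_mem _
  zero_mem' := Submodule.zero_mem _
  smul_mem' := fun T _ hx => quantumAction_mem_quotSet hℓ hq D T.2 hx

variable (hℓ : 3 ≤ ℓ) (hq : QCharEq q ℓ)

lemma mem_quotSpan {D : LowerSet (Fin m → ℕ)} {x : Grassmann K m n} :
    x ∈ quotSpan hℓ hq n r s D ↔ x ∈ monoSpan K (quotSet ℓ r s n D) := Iff.rfl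

lemma mem_truncGrassmann {x : Grassmann K m n} :
    x ∈ truncGrassmann hq m n r s ↔ x ∈ monoSpan K (truncExp m n (r * ℓ) s) := Iff.rfl

lemma quotSpan_le_iff {D : LowerSet (Fin m → ℕ)}
    {N : Submodule (quantumAction q m n) (Grassmann K m n)} :
    quotSpan hℓ hq n r s D ≤ N ↔ ∀ a ∈ quotSet ℓ r s n D, mono K a ∈ N := by
  have h := monoSpan_le_iff (S := quotSet ℓ r s n D) (N := N.restrictScalars K)
  exact ⟨fun h1 => h.1 h1, fun h1 => h.2 h1⟩

lemma quotSpan_mono {D D' : LowerSet (Fin m → ℕ)} (h : D ≤ D') :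
    quotSpan hℓ hq n r s D ≤ quotSpan hℓ hq n r s D' :=
  monoSpan_mono fun _ ha => ⟨ha.1, h ha.2⟩

lemma quotSpan_le_truncGrassmann (D : LowerSet (Fin m → ℕ)) :
    quotSpan hℓ hq n r s D ≤ truncGrassmann hq m n r s :=
  monoSpan_mono fun _ ha => ha.1

lemma apply_mem {N : Submodule (quantumAction q m n) (Grassmann K m n)}
    {T : Module.End K (Grassmann K m n)} (hT : T ∈ quantumAction q m n) {x : Grassmann K m n}
    (hx : x ∈ N) : T x ∈ N :=
  N.smul_mem ⟨T, hT⟩ hx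

/-- Adding the monomials with quotients `κ` to such a submodule gives a simple quotient. -/
lemma quotSpan_covBy {D D' : LowerSet (Fin m → ℕ)} {κ : Fin m → ℕ} (hDD' : D ≤ D')
    (hD' : ∀ κ' ∈ D', κ' ∉ D → κ' = κ) (hκ : κ ∈ D') (hκD : κ ∉ D)
    (hne : ∃ a : SuperExp m n, a ∈ truncExp m n (r * ℓ) s ∧ a.quot ℓ = κ) :
    quotSpan hℓ hq n r s D ⋖ quotSpan hℓ hq n r s D' := by
  refine ⟨lt_of_le_not_ge (quotSpan_mono hℓ hq hDD') fun h => ?_, fun N hN hN' => ?_⟩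
  · obtain ⟨a, ha, hak⟩ := hne
    have h1 : mono K a ∈ quotSpan hℓ hq n r s D := h (mono_mem_monoSpan.2 ⟨ha, hak ▸ hκ⟩)
    exact hκD (hak ▸ (mono_mem_monoSpan.1 h1).2)
  · obtain ⟨hle, v, hv, hvD⟩ := SetLike.lt_iff_le_and_exists.1 hN
    rw [mem_quotSpan, mem_monoSpan_iff] at hvD
    push Not at hvD
    obtain ⟨a₀, ha₀, haD⟩ := hvD
    have hsup := mem_monoSpan_iff.1 (hN'.le hv)
    have hquot : ∀ a, (monoBasis K m n).repr v a ≠ 0 → a ∉ quotSet ℓ r s n D → a.quot ℓ = κ :=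
      fun a ha h => hD' _ (hsup a ha).2 fun h' => h ⟨(hsup a ha).1, h'⟩
    have hk₀ := hquot a₀ ha₀ haD
    -- Modulo the smaller submodule, all terms of v have quotient κ. Projecting to the weight of
    -- `a₀` fixes the residues as well, so only the monomial `a₀` survives.
    obtain ⟨T, hT, hTv⟩ := exists_weight_projection q a₀ v
    have hmono : mono K a₀ ∈ N := by
      have h1 : T v - (monoBasis K m n).repr v a₀ • mono K a₀ ∈ quotSpan hℓ hq n r s D := by
        rw [mem_quotSpan, mem_monoSpan_iff]
        intro a ha
        by_contra haS
        apply ha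
        rw [map_sub, map_smul, repr_mono, Finsupp.sub_apply, Finsupp.smul_apply]
        by_cases haa : a = a₀
        · rw [haa, (hTv a₀).1 fun _ => rfl, Finsupp.single_eq_same]
          simp
        · have hz : (monoBasis K m n).repr (T v) a = 0 := by
            by_cases hw : SameWeight q a₀ a
            · rw [(hTv a).1 hw]
              by_contra hva
              exact haa (SuperExp.eq_of_quot_res (ℓ := ℓ) ((hquot a hva haS).trans hk₀.symm)
                (res_eq_of_sameWeight hℓ hq hw))
            · exact (hTv a).2 hw
          rw [hz, Finsupp.single_eq_of_ne haa]
          simp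
      have h2 := N.sub_mem (apply_mem hT hv) (hle h1)
      rw [sub_sub_cancel] at h2
      exact ((N.restrictScalars K).smul_mem_iff ha₀).1 h2
    refine absurd hN' (not_lt_of_ge ((quotSpan_le_iff hℓ hq).2 fun a ha => ?_))
    by_cases hak : a.quot ℓ ∈ D
    · exact hle (mono_mem_monoSpan.2 ⟨ha.1, hak⟩)
    · have hk := hD' _ ha.2 hak
      have hs : ∑ k, a₀.res ℓ k = ∑ k, a.res ℓ k := by
        have h1 := ((mem_truncExp_iff hℓ).1 (hsup a₀ ha₀).1).2
        have h2 := ((mem_truncExp_iff hℓ).1 ha.1).2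
        rw [energy_eq, hk₀] at h1
        rw [energy_eq, hk] at h2
        omega
      obtain ⟨T', hT', h3⟩ := exists_movesRes hℓ hq (a₀.res_le hℓ) (a.res_le hℓ) hs
      obtain ⟨c, hc, h4⟩ := h3 κ a₀ a (hk₀ ▸ a₀.eq_combine ℓ) (hk ▸ a.eq_combine ℓ)
      have h5 := apply_mem hT' hmono
      rw [h4] at h5
      exact ((N.restrictScalars K).smul_mem_iff hc).1 h5

/-- A submodule with simple quotient by the part of energy less than `E` has energy at most `E`. -/
lemma le_of_quotSpan_sumLower_covBy (hm : 2 ≤ m) {E : ℕ} (hE : s ≤ E * ℓ + (m * (ℓ - 1) + n))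
    {N : Submodule (quantumAction q m n) (Grassmann K m n)} (hNM : N ≤ truncGrassmann hq m n r s)
    (hN : quotSpan hℓ hq n r s (sumLower m E) ⋖ N) :
    N ≤ quotSpan hℓ hq n r s (sumLower m (E + 1)) := by
  classical
  intro v hv
  by_contra hvD
  rw [mem_quotSpan, mem_monoSpan_iff] at hvD
  push Not at hvD
  obtain ⟨a₀, ha₀, haD⟩ := hvD
  have hsup := mem_monoSpan_iff.1 (hNM hv)
  have hen : E + 1 ≤ energy ℓ a₀ := by
    by_contra h
    exact haD ⟨hsup a₀ ha₀, not_le.1 h⟩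
  have hsum := ((mem_truncExp_iff hℓ).1 (hsup a₀ ha₀)).2
  obtain ⟨j, hj⟩ : ∃ j, 0 < a₀.quot ℓ j := by
    by_contra! h
    rw [energy_eq, Finset.sum_eq_zero fun j _ => Nat.le_zero.1 (h j)] at hen
    omega
  obtain ⟨T, hT, hTv⟩ := exists_weight_projection q a₀ v
  -- Energy at least E + 1 uses up one more ℓ than `hE` allows for, which leaves ℓ free places among
  -- the residues.
  have hres : ∑ k, a₀.res ℓ k + ℓ ≤ m * (ℓ - 1) + n := by
    have := Nat.mul_le_mul_right ℓ hen
    rw [Nat.add_mul] at this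
    omega
  obtain ⟨L, hL, b', hb', hLa⟩ := exists_lowering (q := q) hm hℓ hq (a₀.res_le hℓ) hres j
  let S : Set (SuperExp m n) := {a | a ∈ truncExp m n (r * ℓ) s ∧ a.res ℓ = a₀.res ℓ}
  have hw : T v ∈ monoSpan K S := by
    rw [mem_monoSpan_iff]
    intro a ha
    by_cases hwa : SameWeight q a₀ a
    · rw [(hTv a).1 hwa] at ha
      exact ⟨hsup a ha, res_eq_of_sameWeight hℓ hq hwa⟩
    · exact absurd ((hTv a).2 hwa) ha
  have hcomb : ∀ a ∈ S, a.1 = combine ℓ (a.quot ℓ) (a₀.res ℓ) := fun a ha => by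
    rw [← ha.2, ← a.eq_combine]
  obtain ⟨c₁, a₁, hc₁, ha₁, hLa₁⟩ := (hLa _ a₀ (a₀.eq_combine ℓ)).2 hj
  have hq₁ := quot_of_eq_combine hℓ hb' ha₁
  have hen₁ : ∀ κ : Fin m → ℕ, 0 < κ j → ∑ k, Function.update κ j (κ j - 1) k + 1 = ∑ k, κ k := by
    intro κ hκ
    rw [Finset.sum_update_of_mem (Finset.mem_univ j), Finset.sdiff_singleton_eq_erase,
      ← Finset.add_sum_erase _ κ (Finset.mem_univ j)]
    omega
  -- Equal residues and equal degree s force equal energy, so every term of `T v` is killed or drops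
  -- by exactly one energy unit.
  have hLw : L (T v) ∈ quotSpan hℓ hq n r s (sumLower m (energy ℓ a₀)) := by
    have h : monoSpan K S ≤
        (monoSpan K (quotSet ℓ r s n (sumLower m (energy ℓ a₀)))).comap L := by
      rw [monoSpan_le_iff]
      intro a ha
      rw [Submodule.mem_comap]
      rcases Nat.eq_zero_or_pos (a.quot ℓ j) with h0 | h0
      · rw [(hLa _ a (hcomb a ha)).1 h0]
        exact Submodule.zero_mem _
      · obtain ⟨c, a', hc, ha', hLa'⟩ := (hLa _ a (hcomb a ha)).2 h0
        have h1 : L (mono K a) ∈ truncGrassmann hq m n r s :=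
          apply_mem hL ((mem_truncGrassmann hq).2 (mono_mem_monoSpan.2 ha.1))
        rw [hLa', mem_truncGrassmann, Submodule.smul_mem_iff _ hc, mono_mem_monoSpan] at h1
        rw [hLa']
        refine Submodule.smul_mem _ _ (mono_mem_monoSpan.2 ⟨h1, ?_⟩)
        rw [quot_of_eq_combine hℓ hb' ha', mem_sumLower]
        have h2 := ((mem_truncExp_iff hℓ).1 ha.1).2
        rw [ha.2, ← hsum, Nat.add_right_cancel_iff,
          Nat.mul_left_inj (by omega), energy_eq] at h2
        have := hen₁ _ h0
        omega
    exact h hw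
  -- Lowering κ_j is injective where κ_j > 0, so no other term of `T v` can cancel the image of
  -- `a₀`.
  have hcoef : (monoBasis K m n).repr (L (T v)) a₁ = c₁ * (monoBasis K m n).repr v a₀ := by
    have h : Set.EqOn ((Finsupp.lapply a₁ ∘ₗ (monoBasis K m n).repr.toLinearMap) ∘ₗ L)
        (c₁ • (Finsupp.lapply a₀ ∘ₗ (monoBasis K m n).repr.toLinearMap) :
          Grassmann K m n →ₗ[K] K) (mono K '' S) := by
      rintro _ ⟨a, ha, rfl⟩
      change (monoBasis K m n).repr (L (mono K a)) a₁ = c₁ * (monoBasis K m n).repr (mono K a) a₀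
      by_cases haa : a = a₀
      · rw [haa, hLa₁, map_smul, repr_mono, repr_mono]
        simp
      · rw [repr_mono, Finsupp.single_eq_of_ne (Ne.symm haa), mul_zero]
        rcases Nat.eq_zero_or_pos (a.quot ℓ j) with h0 | h0
        · rw [(hLa _ a (hcomb a ha)).1 h0, map_zero, Finsupp.zero_apply]
        · obtain ⟨c, a', hc, ha', hLa'⟩ := (hLa _ a (hcomb a ha)).2 h0
          have hne : a₁ ≠ a' := by
            rintro rfl
            refine haa (SuperExp.eq_of_quot_res (ℓ := ℓ) (funext fun k => ?_) ha.2)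
            have h1 := congrFun ((quot_of_eq_combine hℓ hb' ha').symm.trans hq₁) k
            by_cases hk : k = j
            · subst hk
              simp only [Function.update_self] at h1
              omega
            · simpa [Function.update_of_ne hk] using h1
          rw [hLa', map_smul, repr_mono, Finsupp.smul_apply, Finsupp.single_eq_of_ne hne,
            smul_zero]
    have h1 := LinearMap.eqOn_span h hw
    change (monoBasis K m n).repr (L (T v)) a₁ = c₁ * (monoBasis K m n).repr (T v) a₀ at h1
    rw [h1, (hTv a₀).1 fun _ => rfl]
  have hle : quotSpan hℓ hq n r s (sumLower m E) ≤
      quotSpan hℓ hq n r s (sumLower m (energy ℓ a₀)) ⊓ N :=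
    le_inf (quotSpan_mono hℓ hq fun κ hκ => lt_of_lt_of_le (mem_sumLower.1 hκ) (by omega)) hN.le
  -- The intersection must be one of the two ends. It is not the lower end, since `L (T v)` has the
  -- term `a₁` of energy at least E; it is not N, since v has the term `a₀`.
  rcases hN.eq_or_eq hle inf_le_right with h | h
  · have h1 : L (T v) ∈ quotSpan hℓ hq n r s (sumLower m E) :=
      h ▸ ⟨hLw, apply_mem hL (apply_mem hT hv)⟩
    have h2 := (mem_monoSpan_iff.1 h1 a₁ (by rw [hcoef]; exact mul_ne_zero hc₁ ha₀)).2
    rw [hq₁, mem_sumLower] at h2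
    have := hen₁ _ hj
    rw [energy_eq] at hen
    omega
  · have h1 : v ∈ quotSpan hℓ hq n r s (sumLower m (energy ℓ a₀)) := (h.ge hv).1
    exact lt_irrefl _ (mem_sumLower.1 (mem_monoSpan_iff.1 h1 a₀ ha₀).2)

/-- The two bounds say that the remaining degree s - Eℓ fits into the residues; hence each tuple
counted at energy E really occurs. -/
lemma exists_mem_truncExp_quot {ℓ m n r s : ℕ} (hℓ : 3 ≤ ℓ) {E : ℕ} (hE : s ≤ E * ℓ + (m * (ℓ - 1) + n))
    (hE' : E * ℓ ≤ s) {κ : Fin m → ℕ} (hκ : κ ∈ energyTuples m r E) :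
    ∃ a : SuperExp m n, a ∈ truncExp m n (r * ℓ) s ∧ a.quot ℓ = κ := by
  obtain ⟨b, hb, hs⟩ := exists_le_sum_eq (resBound m n ℓ) (s - E * ℓ)
    (by rw [sum_resBound]; omega)
  have h1 := quot_of_eq_combine (a := combineExp κ hb) hℓ hb rfl
  refine ⟨combineExp κ hb, (mem_truncExp_iff hℓ).2 ⟨fun j => ?_, ?_⟩, h1⟩
  · rw [h1]
    exact hκ.2 j
  · rw [energy_eq, h1, res_of_eq_combine hℓ hb rfl, hs, hκ.1]
    omega

lemma quotSpan_blockLower_empty (E : ℕ) :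
    quotSpan hℓ hq n r s (blockLower E (∅ : Set (Fin m → ℕ))) =
      quotSpan hℓ hq n r s (sumLower m E) := by
  congr 1
  ext κ
  simp [mem_blockLower, mem_sumLower]

/-- The lower sets may differ, but a tuple with an entry at least r is the quotient of no truncated
monomial. -/
lemma quotSpan_blockLower_energyTuples (E : ℕ) :
    quotSpan hℓ hq n r s (blockLower E (energyTuples m r E)) =
      quotSpan hℓ hq n r s (sumLower m (E + 1)) := by
  refine le_antisymm (quotSpan_mono hℓ hq fun κ hκ => ?_) ((quotSpan_le_iff hℓ hq).2 fun a ha => ?_)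
  · rcases hκ with h | h
    · exact mem_sumLower.2 (h.trans (Nat.lt_succ_self E))
    · exact mem_sumLower.2 (h.1 ▸ Nat.lt_succ_self E)
  · refine mono_mem_monoSpan.2 ⟨ha.1, ?_⟩
    rcases (Nat.lt_succ_iff.1 (mem_sumLower.1 ha.2)).lt_or_eq with h | h
    · exact Or.inl h
    · exact Or.inr ⟨h, h, ((mem_truncExp_iff hℓ).1 ha.1).1⟩

lemma quotSpan_blockLower_insert_covBy {E : ℕ} (hE : s ≤ E * ℓ + (m * (ℓ - 1) + n))
    (hE' : E * ℓ ≤ s) {C : Set (Fin m → ℕ)} {κ : Fin m → ℕ} (hκ : κ ∈ energyTuples m r E)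
    (hκC : κ ∉ C) :
    quotSpan hℓ hq n r s (blockLower E C) ⋖ quotSpan hℓ hq n r s (blockLower E (insert κ C)) := by
  refine quotSpan_covBy hℓ hq (κ := κ) ?_ ?_ (Or.inr ⟨hκ.1, Set.mem_insert _ _⟩) ?_
    (exists_mem_truncExp_quot hℓ hE hE' hκ)
  · rintro κ' (h | h)
    · exact Or.inl h
    · exact Or.inr ⟨h.1, Set.mem_insert_of_mem _ h.2⟩
  · rintro κ' (h | ⟨h, rfl | h'⟩) h2
    · exact absurd (Or.inl h) h2
    · rfl
    · exact absurd (Or.inr ⟨h, h'⟩) h2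
  · rintro (h | h)
    · exact h.ne hκ.1
    · exact hκC h.2

/-- A composition chain: tuples of energy E can be added one at a time in any order, each with a
simple quotient. -/
lemma length_quotSpan_blockLower {E : ℕ} (hE : s ≤ E * ℓ + (m * (ℓ - 1) + n)) (hE' : E * ℓ ≤ s)
    (C : Finset (Fin m → ℕ)) (hC : ∀ κ ∈ C, κ ∈ energyTuples m r E) :
    Module.length (quantumAction q m n)
        (quotSpan hℓ hq n r s (blockLower E (C : Set (Fin m → ℕ)))) =
      Module.length (quantumAction q m n) (quotSpan hℓ hq n r s (sumLower m E)) + C.card := by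
  classical
  induction C using Finset.induction_on with
  | empty =>
    rw [Finset.coe_empty, quotSpan_blockLower_empty]
    simp
  | insert κ C hκ ih =>
    rw [Finset.coe_insert, length_eq_add_one_of_covBy (quotSpan_blockLower_insert_covBy hℓ hq hE hE'
      (hC κ (Finset.mem_insert_self _ _)) (by simpa using hκ)),
      ih fun κ' h => hC κ' (Finset.mem_insert_of_mem h), Finset.card_insert_of_notMem hκ]
    push_cast
    rw [add_assoc]

lemma length_quotSpan_sumLower_succ {E : ℕ} (hE : s ≤ E * ℓ + (m * (ℓ - 1) + n))
    (hE' : E * ℓ ≤ s) :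
    Module.length (quantumAction q m n) (quotSpan hℓ hq n r s (sumLower m (E + 1))) =
      Module.length (quantumAction q m n) (quotSpan hℓ hq n r s (sumLower m E)) +
        (energyTuples m r E).ncard := by
  rw [← quotSpan_blockLower_energyTuples, energyTuples_eq, Set.ncard_coe_finset,
    length_quotSpan_blockLower hℓ hq hE hE']
  intro κ hκ
  rwa [energyTuples_eq, Finset.mem_coe]

lemma quotSpan_sumLower_succ_le_sup (E : ℕ) :
    quotSpan hℓ hq n r s (sumLower m (E + 1)) ≤ quotSpan hℓ hq n r s (sumLower m E) ⊔
      sSup ((fun κ => quotSpan hℓ hq n r s (blockLower E {κ})) '' energyTuples m r E) := by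
  rw [quotSpan_le_iff]
  intro a ha
  rcases (Nat.lt_succ_iff.1 (mem_sumLower.1 ha.2)).lt_or_eq with h | h
  · exact Submodule.mem_sup_left (mono_mem_monoSpan.2 ⟨ha.1, h⟩)
  · have h1 : a.quot ℓ ∈ energyTuples m r E := ⟨h, ((mem_truncExp_iff hℓ).1 ha.1).1⟩
    have h2 : mono K a ∈ quotSpan hℓ hq n r s (blockLower E {a.quot ℓ}) :=
      mono_mem_monoSpan.2 ⟨ha.1, Or.inr ⟨h, rfl⟩⟩
    exact Submodule.mem_sup_right (le_sSup (Set.mem_image_of_mem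
      (fun κ => quotSpan hℓ hq n r s (blockLower E {κ})) h1) h2)

end QuotSpan

end

/-! ### The socle filtration of a submodule -/

section SocleOfSubmodule

variable {R G : Type*} [Ring R] [AddCommGroup G] [Module R G] {M : Submodule R G}

lemma map_subtype_covBy_iff {N₁ N₂ : Submodule R M} :
    N₁.map M.subtype ⋖ N₂.map M.subtype ↔ N₁ ⋖ N₂ := by
  refine Set.OrdConnected.apply_covBy_apply_iff
    (OrderEmbedding.ofMapLEIff (Submodule.map M.subtype)
      fun _ _ => Submodule.map_le_map_iff_of_injective M.injective_subtype _ _) ?_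
  refine ⟨?_⟩
  rintro _ - _ ⟨N, rfl⟩ X ⟨-, hX⟩
  exact ⟨X.comap M.subtype, Submodule.map_comap_eq_of_le
    (by rw [Submodule.range_subtype]; exact le_trans hX (Submodule.map_subtype_le M N))⟩

lemma map_subtype_comap {V : Submodule R G} (h : V ≤ M) :
    (V.comap M.subtype).map M.subtype = V :=
  Submodule.map_comap_eq_of_le (by rwa [Submodule.range_subtype])

lemma socleFiltration_le_succ (R M : Type*) [Ring R] [AddCommGroup M] [Module R M] (k : ℕ) :
    socleFiltration R M k ≤ socleFiltration R M (k + 1) := by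
  intro x hx
  rw [socleFiltration, Submodule.mem_comap, Submodule.mkQ_apply,
    (Submodule.Quotient.mk_eq_zero _).2 hx]
  exact Submodule.zero_mem _

/-- The criterion `comap_socle_eq`, transported to submodules of the ambient module, where the
monomial spans live. -/
lemma map_socleFiltration_succ {V W : Submodule R G} {k : ℕ}
    (hV : (socleFiltration R M k).map M.subtype = V) (hVW : V ≤ W) (hWM : W ≤ M)
    (hle : ∀ N ≤ M, V ⋖ N → N ≤ W)
    (hge : ∃ S : Set (Submodule R G), (∀ N ∈ S, N ≤ M ∧ V ⋖ N) ∧ W ≤ V ⊔ sSup S) :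
    (socleFiltration R M (k + 1)).map M.subtype = W := by
  have hF : socleFiltration R M k = V.comap M.subtype := by
    rw [← hV, Submodule.comap_map_eq_of_injective M.injective_subtype]
  have hVM : V ≤ M := hVW.trans hWM
  rw [← map_subtype_comap hWM, socleFiltration, hF]
  congr 1
  refine comap_socle_eq (Submodule.comap_mono hVW) (fun N hN => ?_) ?_
  · rw [← map_subtype_covBy_iff, map_subtype_comap hVM] at hN
    exact Submodule.map_le_iff_le_comap.1 (hle _ (Submodule.map_subtype_le M N) hN)
  · obtain ⟨S, hS, hW⟩ := hge
    refine ⟨Submodule.comap M.subtype '' S, ?_, ?_⟩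
    · rintro _ ⟨N, hN, rfl⟩
      rw [← map_subtype_covBy_iff, map_subtype_comap hVM, map_subtype_comap (hS N hN).1]
      exact (hS N hN).2
    · rw [← Submodule.map_le_map_iff_of_injective M.injective_subtype, map_subtype_comap hWM,
        Submodule.map_sup, map_subtype_comap hVM]
      refine hW.trans (sup_le_sup_left (sSup_le fun N hN => ?_) _)
      rw [← map_subtype_comap (hS N hN).1]
      exact Submodule.map_mono (le_sSup ⟨N, hN, rfl⟩)

lemma length_map_socleFiltration_succ (M : Submodule R G) (k : ℕ) :
    Module.length R ((socleFiltration R M (k + 1)).map M.subtype) =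
      Module.length R ((socleFiltration R M k).map M.subtype) +
        Module.length R (LoewyLayer R M k) := by
  rw [← (Submodule.equivMapOfInjective M.subtype M.injective_subtype _).length_eq,
    ← (Submodule.equivMapOfInjective M.subtype M.injective_subtype _).length_eq]
  exact length_eq_add_length_quotient (socleFiltration_le_succ R M k)

lemma finrank_eq_add_finrank_quotient (K : Type*) [Field K] [Algebra K R] [Module K G]
    [IsScalarTower K R G] {V W : Submodule R G} (hVW : V ≤ W) [Module.Finite K W] :
    Module.finrank K W = Module.finrank K V + Module.finrank K (W ⧸ V.submoduleOf W) := by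
  have h1 := LinearMap.finrank_range_add_finrank_ker
    ((V.submoduleOf W).mkQ.restrictScalars K)
  have h2 : LinearMap.range ((V.submoduleOf W).mkQ.restrictScalars K) = ⊤ := by
    rw [LinearMap.range_eq_top, LinearMap.coe_restrictScalars]
    exact Submodule.mkQ_surjective (V.submoduleOf W)
  have h4 : LinearMap.ker ((V.submoduleOf W).mkQ.restrictScalars K) =
      (V.submoduleOf W).restrictScalars K := by
    ext x
    simp
  have h3 : Module.finrank K (V.submoduleOf W) = Module.finrank K V :=
    ((Submodule.submoduleOfEquivOfLe hVW).restrictScalars K).finrank_eq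
  have h5 : Module.finrank K ((V.submoduleOf W).restrictScalars K) =
      Module.finrank K (V.submoduleOf W) := rfl
  rw [h2, h4, h5, h3, finrank_top] at h1
  rw [← h1, add_comm]

lemma finrank_map_subtype (K : Type*) [Field K] [Algebra K R] [Module K G]
    [IsScalarTower K R G] (N : Submodule R M) :
    Module.finrank K (N.map M.subtype) = Module.finrank K N :=
  ((Submodule.equivMapOfInjective M.subtype M.injective_subtype
    N).restrictScalars K).finrank_eq.symm

lemma finrank_map_socleFiltration_succ (K : Type*) [Field K] [Algebra K R] [Module K G]
    [IsScalarTower K R G] (M : Submodule R G) [Module.Finite K M] (k : ℕ) :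
    Module.finrank K ((socleFiltration R M (k + 1)).map M.subtype) =
      Module.finrank K ((socleFiltration R M k).map M.subtype) +
        Module.finrank K (LoewyLayer R M k) := by
  have hfin : Module.Finite K (socleFiltration R M (k + 1)) :=
    inferInstanceAs (Module.Finite K ((socleFiltration R M (k + 1)).restrictScalars K))
  rw [finrank_map_subtype, finrank_map_subtype]
  exact finrank_eq_add_finrank_quotient K (socleFiltration_le_succ R M k)

end SocleOfSubmodule

/-! ### Counting monomials by energy -/

section EnergyCount

variable {ℓ m n r s : ℕ}

lemma mul_energy_le (ℓ : ℕ) {a : SuperExp m n} {b : ℕ} (ha : a ∈ truncExp m n b s) :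
    energy ℓ a * ℓ ≤ s := by
  rw [← ha.2, a.sum_eq ℓ]
  exact Nat.le_add_right _ _

lemma nonempty_truncExp (hℓ : 3 ≤ ℓ) (hr : 1 ≤ r) (hs : s ≤ m * (r * ℓ - 1) + n) :
    (truncExp m n (r * ℓ) s).Nonempty := by
  have hrl : 1 ≤ r * ℓ := Nat.mul_pos hr (by omega)
  obtain ⟨b, hb, hbs⟩ := exists_le_sum_eq (resBound m n (r * ℓ)) s (by rwa [sum_resBound])
  have hb' : ∀ i, b i ≤ resBound m n (r * ℓ) i := hb
  refine ⟨⟨b, fun i hi => ?_⟩, fun i hi => ?_, hbs⟩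
  · have := hb' i
    rwa [resBound, if_neg (by omega)] at this
  · have := hb' i
    rw [resBound, if_pos hi] at this
    change b i < r * ℓ
    omega

/-- Needed for the supremum in `maxEnergy` to be an attained maximum rather than a default value. -/
lemma bddAbove_energy (hℓ : 3 ≤ ℓ) : BddAbove (energy ℓ '' truncExp m n (r * ℓ) s) := by
  refine ⟨s, ?_⟩
  rintro _ ⟨a, ha, rfl⟩
  exact (Nat.le_mul_of_pos_right _ (by omega)).trans (mul_energy_le ℓ ha)

lemma minEnergy_le {a : SuperExp m n} (ha : a ∈ truncExp m n (r * ℓ) s) :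
    minEnergy m n ℓ r s ≤ energy ℓ a :=
  Nat.sInf_le ⟨a, ha, rfl⟩

lemma le_maxEnergy (hℓ : 3 ≤ ℓ) {a : SuperExp m n} (ha : a ∈ truncExp m n (r * ℓ) s) :
    energy ℓ a ≤ maxEnergy m n ℓ r s :=
  le_csSup (bddAbove_energy hℓ) ⟨a, ha, rfl⟩

lemma maxEnergy_mul_le (hℓ : 3 ≤ ℓ) (hr : 1 ≤ r) (hs : s ≤ m * (r * ℓ - 1) + n) :
    maxEnergy m n ℓ r s * ℓ ≤ s := by
  obtain ⟨a, ha, h⟩ := Nat.sSup_mem ((nonempty_truncExp hℓ hr hs).image (energy ℓ))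
    (bddAbove_energy hℓ)
  rw [maxEnergy, ← h]
  exact mul_energy_le ℓ ha

lemma le_minEnergy_mul_add (hℓ : 3 ≤ ℓ) (hr : 1 ≤ r) (hs : s ≤ m * (r * ℓ - 1) + n) :
    s ≤ minEnergy m n ℓ r s * ℓ + (m * (ℓ - 1) + n) := by
  obtain ⟨a, ha, h⟩ := Nat.sInf_mem ((nonempty_truncExp hℓ hr hs).image (energy ℓ))
  rw [minEnergy, ← h, ← sum_resBound, ← ((mem_truncExp_iff hℓ).1 ha).2]
  exact Nat.add_le_add_left (Finset.sum_le_sum fun k _ => a.res_le hℓ k) _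

lemma minEnergy_le_maxEnergy (hℓ : 3 ≤ ℓ) (hr : 1 ≤ r) (hs : s ≤ m * (r * ℓ - 1) + n) :
    minEnergy m n ℓ r s ≤ maxEnergy m n ℓ r s := by
  obtain ⟨a, ha⟩ := nonempty_truncExp hℓ hr hs
  exact (minEnergy_le ha).trans (le_maxEnergy hℓ ha)

/-- The exponent given by the residues of `a`. -/
def SuperExp.resExp (ℓ : ℕ) (a : SuperExp m n) : SuperExp m n :=
  ⟨a.res ℓ, fun i hi => by
    rw [res, if_neg (by omega)]
    exact a.2 i hi⟩

/-- Division with remainder is a bijection, and once the energy is E the residues have degree s - Eℓ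
independently of κ. -/
lemma ncard_energy_eq (hℓ : 3 ≤ ℓ) {E : ℕ} (hE : E * ℓ ≤ s) :
    {a : SuperExp m n | a ∈ truncExp m n (r * ℓ) s ∧ energy ℓ a = E}.ncard =
      (energyTuples m r E).ncard * (truncExp m n (1 * ℓ) (s - E * ℓ)).ncard := by
  rw [← Set.ncard_prod, ← Set.ncard_image_of_injective
    {a : SuperExp m n | a ∈ truncExp m n (r * ℓ) s ∧ energy ℓ a = E}
    (f := fun a => (a.quot ℓ, a.resExp ℓ))]
  · congr 1
    ext ⟨κ, b⟩
    rw [Set.mem_prod]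
    constructor
    · rintro ⟨a, ⟨ha, hE'⟩, h⟩
      obtain ⟨rfl, rfl⟩ := Prod.mk.inj h
      have h1 := (mem_truncExp_iff hℓ).1 ha
      refine ⟨⟨hE', h1.1⟩, fun i hi => ?_, ?_⟩
      · change a.res ℓ i < 1 * ℓ
        rw [SuperExp.res, if_pos hi, one_mul]
        exact Nat.mod_lt _ (by omega)
      · change ∑ k, a.res ℓ k = s - E * ℓ
        rw [← h1.2, hE', Nat.add_sub_cancel_left]
    · rintro ⟨hκ, hb1, hb2⟩
      have hb : b.1 ≤ resBound m n ℓ := by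
        intro k
        unfold resBound
        split_ifs with hk
        · have : b.1 k < 1 * ℓ := hb1 k hk
          change b.1 k ≤ ℓ - 1
          omega
        · exact b.2 k (by omega)
      have h1 := quot_of_eq_combine (a := combineExp κ hb) hℓ hb rfl
      have h2 := res_of_eq_combine (a := combineExp κ hb) hℓ hb rfl
      have h3 : energy ℓ (combineExp κ hb) = E := by
        rw [energy_eq, h1]
        exact hκ.1
      refine ⟨combineExp κ hb, ⟨(mem_truncExp_iff hℓ).2 ⟨fun j => ?_, ?_⟩, h3⟩, ?_⟩
      · rw [h1]
        exact hκ.2 j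
      · rw [h3, h2, hb2]
        omega
      · exact Prod.ext h1 (Subtype.ext h2)
  · intro a b h
    obtain ⟨h1, h2⟩ := Prod.mk.inj h
    exact SuperExp.eq_of_quot_res h1 (congrArg Subtype.val h2)

lemma ncard_quotSet_succ (hℓ : 3 ≤ ℓ) {E : ℕ} (hE : E * ℓ ≤ s) :
    (quotSet ℓ r s n (sumLower m (E + 1))).ncard = (quotSet ℓ r s n (sumLower m E)).ncard +
      (energyTuples m r E).ncard * (truncExp m n (1 * ℓ) (s - E * ℓ)).ncard := by
  have hfin := finite_truncExp m n (r * ℓ) s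
  rw [← ncard_energy_eq hℓ hE, ← Set.ncard_union_eq ?_ (hfin.subset fun a ha => ha.1)
    (hfin.subset fun a ha => ha.1)]
  · congr 1
    ext a
    constructor
    · rintro ⟨ha, h⟩
      rcases (Nat.lt_succ_iff.1 (mem_sumLower.1 h)).lt_or_eq with h | h
      · exact Or.inl ⟨ha, h⟩
      · exact Or.inr ⟨ha, h⟩
    · rintro (⟨ha, h⟩ | ⟨ha, h⟩)
      · exact ⟨ha, lt_trans h (Nat.lt_succ_self E)⟩
      · exact ⟨ha, Nat.lt_succ_iff.2 (le_of_eq h)⟩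
  · refine Set.disjoint_left.2 fun a h1 h2 => ?_
    exact (mem_sumLower.1 h1.2).ne h2.2

lemma quotSet_minEnergy : quotSet ℓ r s n (sumLower m (minEnergy m n ℓ r s)) = ∅ :=
  Set.eq_empty_of_forall_notMem fun _ ha => absurd (minEnergy_le ha.1) (not_le.2 ha.2)

lemma quotSet_maxEnergy_succ (hℓ : 3 ≤ ℓ) :
    quotSet ℓ r s n (sumLower m (maxEnergy m n ℓ r s + 1)) = truncExp m n (r * ℓ) s :=
  Set.ext fun _ => ⟨fun ha => ha.1, fun ha => ⟨ha, Nat.lt_succ_iff.2 (le_maxEnergy hℓ ha)⟩⟩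

lemma ncard_truncExp_eq_sum (hℓ : 3 ≤ ℓ) (hr : 1 ≤ r) (hs : s ≤ m * (r * ℓ - 1) + n) :
    (truncExp m n (r * ℓ) s).ncard =
      ∑ i ∈ range (maxEnergy m n ℓ r s - minEnergy m n ℓ r s + 1),
        (energyTuples m r (minEnergy m n ℓ r s + i)).ncard *
          (truncExp m n (1 * ℓ) (s - (minEnergy m n ℓ r s + i) * ℓ)).ncard := by
  have hle := minEnergy_le_maxEnergy hℓ hr hs
  have hmax := maxEnergy_mul_le hℓ hr hs
  have h : ∀ k ≤ maxEnergy m n ℓ r s - minEnergy m n ℓ r s + 1,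
      (quotSet ℓ r s n (sumLower m (minEnergy m n ℓ r s + k))).ncard = ∑ i ∈ range k,
        (energyTuples m r (minEnergy m n ℓ r s + i)).ncard *
          (truncExp m n (1 * ℓ) (s - (minEnergy m n ℓ r s + i) * ℓ)).ncard := by
    intro k
    induction k with
    | zero => simp [quotSet_minEnergy]
    | succ k ih =>
      intro hk
      have h1 : (minEnergy m n ℓ r s + k) * ℓ ≤ maxEnergy m n ℓ r s * ℓ :=
        Nat.mul_le_mul_right _ (by omega)
      rw [Finset.sum_range_succ, ← ih (by omega), ← add_assoc,
        ncard_quotSet_succ hℓ (h1.trans hmax)]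
  rw [← h _ le_rfl, ← quotSet_maxEnergy_succ hℓ, ← add_assoc, Nat.add_sub_cancel' hle]

end EnergyCount

/-! ### The Loewy filtration -/

section Loewy

variable {K : Type*} [Field K] {q : K} {ℓ m n r s : ℕ} (hℓ : 3 ≤ ℓ) (hq : QCharEq q ℓ)

lemma finrank_quotSpan (D : LowerSet (Fin m → ℕ)) :
    Module.finrank K (quotSpan hℓ hq n r s D) = (quotSet ℓ r s n D).ncard :=
  finrank_monoSpan (K := K) (quotSet ℓ r s n D)

lemma finrank_truncGrassmann :
    Module.finrank K (truncGrassmann hq m n r s) = (truncExp m n (r * ℓ) s).ncard :=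
  finrank_monoSpan (K := K) (truncExp m n (r * ℓ) s)

instance finite_truncGrassmann : Module.Finite K (truncGrassmann hq m n r s) := by
  have : Module.Finite K (monoSpan K (truncExp m n (r * ℓ) s)) :=
    FiniteDimensional.span_of_finite K ((finite_truncExp m n (r * ℓ) s).image _)
  exact this

/-- Finite dimension over K gives finite length, which is what permits cancelling lengths in `ℕ∞`.
-/
lemma length_quotSpan_ne_top (D : LowerSet (Fin m → ℕ)) :
    Module.length (quantumAction q m n) (quotSpan hℓ hq n r s D) ≠ ⊤ := by
  have : Module.Finite K (monoSpan K (quotSet ℓ r s n D)) :=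
    FiniteDimensional.span_of_finite K
      (((finite_truncExp m n (r * ℓ) s).subset fun _ ha => ha.1).image _)
  have h1 : IsNoetherian K (quotSpan hℓ hq n r s D) :=
    (inferInstance : IsNoetherian K (monoSpan K (quotSet ℓ r s n D)))
  have h2 : IsArtinian K (quotSpan hℓ hq n r s D) :=
    (inferInstance : IsArtinian K (monoSpan K (quotSet ℓ r s n D)))
  have : IsNoetherian (quantumAction q m n) (quotSpan hℓ hq n r s D) :=
    isNoetherian_of_tower K h1
  have : IsArtinian (quantumAction q m n) (quotSpan hℓ hq n r s D) :=
    isArtinian_of_tower K h2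
  exact Module.length_ne_top

lemma map_socleFiltration_truncGrassmann (hm : 2 ≤ m) (hr : 1 ≤ r)
    (hs : s ≤ m * (r * ℓ - 1) + n) (k : ℕ)
    (hk : k ≤ maxEnergy m n ℓ r s - minEnergy m n ℓ r s + 1) :
    (socleFiltration (quantumAction q m n) (truncGrassmann hq m n r s) k).map
        (truncGrassmann hq m n r s).subtype =
      quotSpan hℓ hq n r s (sumLower m (minEnergy m n ℓ r s + k)) := by
  induction k with
  | zero =>
    rw [socleFiltration, Submodule.map_bot, eq_comm, eq_bot_iff, quotSpan_le_iff, add_zero,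
      quotSet_minEnergy]
    exact fun a ha => absurd ha (Set.notMem_empty a)
  | succ k ih =>
    have hle := minEnergy_le_maxEnergy hℓ hr hs
    -- The extreme energies are attained: the maximum gives this bound and the minimum the next, so
    -- both hold at every level in between.
    have h1 : (minEnergy m n ℓ r s + k) * ℓ ≤ s :=
      (Nat.mul_le_mul_right _ (by omega)).trans (maxEnergy_mul_le hℓ hr hs)
    have h2 : s ≤ (minEnergy m n ℓ r s + k) * ℓ + (m * (ℓ - 1) + n) :=
      (le_minEnergy_mul_add hℓ hr hs).trans
        (Nat.add_le_add_right (Nat.mul_le_mul_right _ (by omega)) _)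
    rw [← add_assoc]
    refine map_socleFiltration_succ (ih (by omega))
      (quotSpan_mono hℓ hq fun κ hκ => lt_trans (mem_sumLower.1 hκ) (Nat.lt_succ_self _))
      (quotSpan_le_truncGrassmann hℓ hq _)
      (fun N hNM hN => le_of_quotSpan_sumLower_covBy hℓ hq hm h2 hNM hN)
      ⟨_, ?_, quotSpan_sumLower_succ_le_sup hℓ hq _⟩
    rintro _ ⟨κ, hκ, rfl⟩
    refine ⟨quotSpan_le_truncGrassmann hℓ hq _, ?_⟩
    have h3 := quotSpan_blockLower_insert_covBy hℓ hq h2 h1 hκ (Set.notMem_empty κ)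
    rwa [quotSpan_blockLower_empty, insert_empty_eq] at h3

end Loewy

theorem corollary24 {K : Type*} [Field K] [CharZero K] (q : K) (ℓ : ℕ)
    (hℓ : 3 ≤ ℓ) (hq : QCharEq q ℓ) (m n r s : ℕ) (hm : 2 ≤ m) (hr : 1 ≤ r)
    (hs : s ≤ m * (r * ℓ - 1) + n) :
    (∀ i ≤ maxEnergy m n ℓ r s - minEnergy m n ℓ r s,
      -- the Loewy filtration is given by the energy grade
      ((socleFiltration (quantumAction q m n) (truncGrassmann hq m n r s) (i + 1)).map
          (truncGrassmann hq m n r s).subtype).restrictScalars K =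
        monoSpan K {a | a ∈ truncExp m n (r * ℓ) s ∧ energy ℓ a ≤ minEnergy m n ℓ r s + i} ∧
      -- the number of simple constituents of the `i`-th Loewy layer
      IsSemisimpleModule (quantumAction q m n)
        (LoewyLayer (quantumAction q m n) (truncGrassmann hq m n r s) i) ∧
      Module.length (quantumAction q m n)
          (LoewyLayer (quantumAction q m n) (truncGrassmann hq m n r s) i) =
        ((energyTuples m r (minEnergy m n ℓ r s + i)).ncard : ℕ∞) ∧
      ((energyTuples m r (minEnergy m n ℓ r s + i)).ncard : ℤ) =
        tupleSum m r (minEnergy m n ℓ r s + i) ∧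
      -- the dimension of the `i`-th Loewy layer
      (minEnergy m n ℓ r s + i) * ℓ ≤ s ∧
      s - (minEnergy m n ℓ r s + i) * ℓ ≤ m * (ℓ - 1) + n ∧
      Module.finrank K (LoewyLayer (quantumAction q m n) (truncGrassmann hq m n r s) i) =
        (energyTuples m r (minEnergy m n ℓ r s + i)).ncard *
          Module.finrank K
            (truncGrassmann hq m n 1 (s - (minEnergy m n ℓ r s + i) * ℓ)) ∧
      (Module.finrank K
          (truncGrassmann hq m n 1 (s - (minEnergy m n ℓ r s + i) * ℓ)) : ℤ) =
        dimSum m n ℓ (s - (minEnergy m n ℓ r s + i) * ℓ)) ∧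
    -- the dimension of the whole module
    (Module.finrank K (truncGrassmann hq m n r s) : ℤ) = dimSum m n (r * ℓ) s ∧
    dimSum m n (r * ℓ) s =
      ∑ i ∈ Finset.range (maxEnergy m n ℓ r s - minEnergy m n ℓ r s + 1),
        tupleSum m r (minEnergy m n ℓ r s + i) *
          dimSum m n ℓ (s - (minEnergy m n ℓ r s + i) * ℓ) := by
  have hrl : 1 ≤ r * ℓ := Nat.mul_pos hr (by omega)
  have hdim : ∀ t, ((truncExp m n (1 * ℓ) t).ncard : ℤ) = dimSum m n ℓ t := fun t => by
    rw [one_mul, ncard_truncExp (by omega) (by omega)]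
  refine ⟨fun i hi => ?_, ?_, ?_⟩
  · have hle := minEnergy_le_maxEnergy hℓ hr hs
    have h1 : (minEnergy m n ℓ r s + i) * ℓ ≤ s :=
      (Nat.mul_le_mul_right _ (by omega)).trans (maxEnergy_mul_le hℓ hr hs)
    have h2 : s ≤ (minEnergy m n ℓ r s + i) * ℓ + (m * (ℓ - 1) + n) :=
      (le_minEnergy_mul_add hℓ hr hs).trans
        (Nat.add_le_add_right (Nat.mul_le_mul_right _ (by omega)) _)
    have h3 := map_socleFiltration_truncGrassmann hℓ hq hm hr hs i (by omega)
    have h4 := map_socleFiltration_truncGrassmann hℓ hq hm hr hs (i + 1) (by omega)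
    rw [← add_assoc] at h4
    refine ⟨?_, inferInstance, ?_, ncard_energyTuples (by omega) hr _, h1, by omega, ?_, ?_⟩
    · rw [h4]
      change monoSpan K _ = monoSpan K _
      congr 1
      ext a
      exact and_congr_right fun _ => Nat.lt_succ_iff
    · have h5 := length_map_socleFiltration_succ (truncGrassmann hq m n r s) i
      rw [h3, h4, length_quotSpan_sumLower_succ hℓ hq h2 h1] at h5
      -- Both sides count the length of the same term of the filtration; the finite length of the
      -- preceding term is cancelled.
      exact ((ENat.addLECancellable_of_ne_top (length_quotSpan_ne_top hℓ hq _)).inj.1 h5).symm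
    · have h5 := finrank_map_socleFiltration_succ K (truncGrassmann hq m n r s) i
      rw [h3, h4, finrank_quotSpan, finrank_quotSpan, ncard_quotSet_succ hℓ h1] at h5
      rw [finrank_truncGrassmann]
      omega
    · rw [finrank_truncGrassmann, hdim]
  · rw [finrank_truncGrassmann, ncard_truncExp (by omega) hrl]
  · rw [← ncard_truncExp (by omega) hrl, ncard_truncExp_eq_sum hℓ hr hs]
    push_cast
    refine Finset.sum_congr rfl fun i _ => ?_
    rw [ncard_energyTuples (by omega) hr, hdim]
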